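/- Let $\mathbb T=\mathbb R/2\pi\mathbb Z$. For $s\in\mathbb R$ and $f=\sum_{n\in\mathbb Z}c_ne^{inx}$ put $\|f\|_s^2=\sum_{n}|c_n|^2(1+|n|^2)^s$; all functions are real-valued, and $H^s=H^s(\mathbb T)$ is the space of those with $\|f\|_s<\infty$. Let $a:\mathbb T\to[0,\infty)$ be smooth and let $\omega\subset\mathbb T$ be an open set with $a>0$ on $\omega$. Consider the damped BBM equation $u_t-u_{xxt}+u_x+uu_x+a(x)u=0$, $u(0)=u_0$, in integral form $$u(t)=u_0-\int_0^t(1-\partial_x^2)^{-1}\Big[a\,u+\Big(u+\frac{u^2}{2}\Big)_x\Big](\tau)\,d\tau .\qquad(1)$$ The undamped BBM equation is (1) with $a=0$. For $\delta>0$ let $\mathrm{UCP}(\delta)$ be the statement: whenever $v_0\in H^1$, $\|v_0\|_1<\delta$, and the solution $v$ of the undamped equation with $v(0)=v_0$ vanishes on $\omega'\times(0,T)$ for some nonempty open $\omega'\subset\mathbb T$ and some $T>0$, then $v_0=0$. (The UCP conjecture asserts that $\mathrm{UCP}(\delta)$ holds for some $\delta>0$.) **Theorem.** 1. Let $s\ge0$.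 For every $\rho>0$ there is $T>0$ such that (1) has a solution $u\in C([0,T],H^s)$ for every $u_0\in H^s$ with $\|u_0\|_s\le\rho$, and any two solutions $u,w\in C([0,T],H^s)$ with data $u_0,w_0$ in this ball satisfy $\sup_{0\le t\le T}\|u(t)-w(t)\|_s\le 2\|u_0-w_0\|_s$. Moreover, for every $T>0$ and $u_0\in H^s$, (1) has at most one solution in $C([0,T],H^s)$. 2. For every $u_0\in H^1$ there is a solution $u\in C([0,\infty),H^1)$ of (1), and $t\mapsto\|u(t)\|_1^2$ is nonincreasing on $[0,\infty)$. 3. Let $u$ be as in 2 and let $v_0\in H^1$ be the weak limit in $H^1$ of $u(t_n)$ for some sequence $t_n\to+\infty$. Then the undamped equation has a solution $v\in C([0,\infty),H^1)$ with $v(0)=v_0$; and, for every $T>0$, every solution $v\in C([0,T],H^1)$ of the undamped equation with $v(0)=v_0$ vanishes on $\omega\times(0,T)$. If moreover $\omega\neq\emptyset$, $\mathrm{UCP}(\delta)$ holds for some $\delta>0$, and $\|u_0\|_1<\delta$ or $\|v_0\|_1<\delta$, then $v_0=0$. 4. Let $u$ be as in 2. If $\omega\ne\emptyset$, $\mathrm{UCP}(\delta)$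 holds for some $\delta>0$, and $\|u_0\|_1<\delta$, then, as $t\to+\infty$, $u(t)\to0$ weakly in $H^1$ and strongly in $H^s$ for every $s<1$. -/

import Mathlib

open MeasureTheory Filter Topology

noncomputable section

namespace BBM

instance fact_two_pi_pos : Fact (0 < 2 * Real.pi) := ⟨Real.two_pi_pos⟩

/-- The one-dimensional torus `ℝ / 2πℤ`. -/
abbrev Torus : Type := AddCircle (2 * Real.pi)

/-- Normalised Lebesgue measure `dx / 2π` on the torus. -/
abbrev torusMeasure : Measure Torus := AddCircle.haarAddCircle

/-- The space of real-valued square-integrable functions on the torus. -/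
abbrev L2 : Type := Lp ℝ 2 torusMeasure

/-- `n`-th Fourier coefficient `c_n` of a real-valued function, so that `f = ∑ c_n e^{inx}`. -/
def coeff (f : Torus → ℝ) (n : ℤ) : ℂ := fourierCoeff (fun x => (f x : ℂ)) n

/-- Membership of `f ∈ L²` in the Sobolev space `H^s`. For `s ≥ 0` these are all the
elements of `H^s`. -/
def MemH (s : ℝ) (f : L2) : Prop :=
  Summable fun n : ℤ => ‖coeff f n‖ ^ 2 * (1 + (n : ℝ) ^ 2) ^ s

/-- The norm `‖·‖_s` of `H^s`. -/
def normH (s : ℝ) (f : L2) : ℝ :=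
  Real.sqrt (∑' n : ℤ, ‖coeff f n‖ ^ 2 * (1 + (n : ℝ) ^ 2) ^ s)

/-- The (real) inner product of `H^s`. -/
def innerH (s : ℝ) (f g : L2) : ℝ :=
  ∑' n : ℤ, (coeff f n * (starRingEnd ℂ) (coeff g n)).re * (1 + (n : ℝ) ^ 2) ^ s

/-- `u i` converges to `v` weakly in the Hilbert space `H^s`, along the filter `l`. -/
def WeakTendstoH {ι : Type*} (s : ℝ) (u : ι → L2) (l : Filter ι) (v : L2) : Prop :=
  (∀ᶠ i in l, MemH s (u i)) ∧ MemH s v ∧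
    ∀ φ : L2, MemH s φ → Tendsto (fun i => innerH s (u i) φ) l (𝓝 (innerH s v φ))

/-- `u ∈ C([0,T]; H^s)`. -/
def ContinuousInH (s T : ℝ) (u : ℝ → L2) : Prop :=
  (∀ t ∈ Set.Icc 0 T, MemH s (u t)) ∧
    ∀ t ∈ Set.Icc 0 T, Tendsto (fun τ => normH s (u τ - u t)) (𝓝[Set.Icc 0 T] t) (𝓝 0)

/-- The derivative `∂_x`, acting on the Fourier coefficients of periodic distributions. -/
def ddx (c : ℤ → ℂ) (n : ℤ) : ℂ := Complex.I * n * c n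

/-- The operator `(1 - ∂_x²)⁻¹`, acting on the Fourier coefficients of periodic distributions. -/
def invHelmholtz (c : ℤ → ℂ) (n : ℤ) : ℂ := c n / (1 + (n : ℂ) ^ 2)

/-- The real-valued function `∑ c_n e^{inx}` of `L²` with given Fourier coefficients
(square-summable, with `c_{-n}` the conjugate of `c_n`). -/
def ofCoeff (c : ℤ → ℂ) : L2 :=
  Complex.reCLM.compLp (∑' n : ℤ, c n • (fourierLp 2 n : Lp ℂ 2 torusMeasure))

/-- The nonlinear operator `u ↦ (1 - ∂_x²)⁻¹ [a u + (u + u²/2)_x]`. -/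
def field (a : Torus → ℝ) (u : L2) : L2 :=
  ofCoeff (invHelmholtz (coeff (fun x => a x * u x) + ddx (coeff fun x => u x + u x ^ 2 / 2)))

/-- `u ∈ C([0,T]; H^s)` solves the integral form of `u_t - u_xxt + u_x + u u_x + a u = 0`,
`u(0) = u₀`, on `[0,T]`. -/
def IsSolutionOn (a : Torus → ℝ) (s T : ℝ) (u₀ : L2) (u : ℝ → L2) : Prop :=
  ContinuousInH s T u ∧
    ∀ t ∈ Set.Icc 0 T, u t = u₀ - ∫ τ in (0 : ℝ)..t, field a (u τ)

/-- A solution on `[0,∞)`, in `C([0,∞); H^s)`. -/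
def IsGlobalSolution (a : Torus → ℝ) (s : ℝ) (u₀ : L2) (u : ℝ → L2) : Prop :=
  ∀ T : ℝ, 0 < T → IsSolutionOn a s T u₀ u

/-- `v` vanishes on `ω × (0,T)`. (For `v(t) ∈ H¹` and `ω` open, vanishing almost everywhere on `ω`
is the vanishing on `ω` of the continuous representative of `v(t)`.) -/
def VanishesOn (ω : Set Torus) (T : ℝ) (v : ℝ → L2) : Prop :=
  ∀ t ∈ Set.Ioo 0 T, ∀ᵐ x ∂torusMeasure, x ∈ ω → v t x = 0

/-- The unique continuation property for the undamped BBM equation and for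
initial data in the open ball of radius `δ` of `H¹`. -/
def UCPBelow (δ : ℝ) : Prop :=
  ∀ v₀ : L2, MemH 1 v₀ → normH 1 v₀ < δ →
    ∀ ω : Set Torus, IsOpen ω → ω.Nonempty → ∀ T : ℝ, 0 < T →
      ∀ v : ℝ → L2, IsSolutionOn 0 1 T v₀ v → VanishesOn ω T v → v₀ = 0

end BBM

end

/-!
The substitution `z = (1 - ∂_x²)^{s/2} u` identifies `H^s` with `L²` and turns the integral equation
into an ordinary differential equation `z' = -G_s(z)` in the Hilbert space `L²`
(`stateField`, `IsSolutionOn.isIntegralSolution`). Everything rests on two properties of `G_s`.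

*Size.* The weight `(1 + n²)^{s/2}` is submultiplicative up to a constant, so the weighted
coefficients of a product of two functions of `H^s` are bounded by Cauchy-Schwarz
(`wt_mul_norm_coeff_mul_le`). The multipliers `1/(1 + n²)` and `n/(1 + n²)` are square-summable, and
so `G_s` maps `L²` to itself and is Lipschitz on balls, with a constant that grows linearly with the
radius (`quadraticLipschitz_stateField`). Local well-posedness and uniqueness follow from the
theorems of Picard-Lindelöf and Grönwall.

*Dissipation.* For `s = 1` one has `⟪z, G_1 z⟫ = ∫ a u²` (`inner_stateField`): the linear dispersive
term contributes a purely imaginary sum, and `∫ u² u_x = 0` because the sum of `n c_n c_k c_m` over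
`n + k + m = 0` can be symmetrised (`hasSum_cubic_form`). Hence the `H¹` norm does not increase. A
bounded truncation of `G_1` outside a ball has the same sign, so that its solutions, which are
global, stay in the ball and are solutions of the equation
(`QuadraticLipschitz.exists_solution_of_inner_nonneg`).

Let now `u(t_i)` tend weakly in `H¹` to `v₀`. The convergence is strong in `L²`
(`tendsto_normH_of_tendsto_coeff`), and Grönwall's inequality in `L²` shows that `u(t_i + ·)` tends
to the damped solution `v` issued from `v₀`, uniformly on compact intervals. As the energy of `u`
converges, its dissipation over `[t_i, t_i + T]` tends to zero, and therefore `v` has no dissipation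
(`dissipation_eq_zero_of_weakTendstoH`). Then `a v = 0`, so `v` is the solution of the undamped
equation and vanishes where `a > 0`. Under unique continuation `v₀ = 0`. Since the balls of `H¹` are
weakly compact, it follows that all of `u(t)` tends to zero weakly in `H¹`, and strongly in the
larger spaces.
-/

noncomputable section

namespace BBM

/-! ### Fourier coefficients of real square-integrable functions -/

/-- The complexification of a real-valued square-integrable function. -/
def toComplex : L2 →L[ℝ] Lp ℂ 2 torusMeasure :=
  Complex.ofRealCLM.compLpL 2 torusMeasure

lemma toComplex_ae (f : L2) : toComplex f =ᵐ[torusMeasure] fun x => (f x : ℂ) :=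
  Complex.ofRealCLM.coeFn_compLp f

lemma coeff_congr {f g : Torus → ℝ} (h : f =ᵐ[torusMeasure] g) : coeff f = coeff g := by
  refine fourierCoeff_congr_ae ?_
  filter_upwards [h] with x hx
  simp [hx]

lemma repr_toComplex (f : L2) (n : ℤ) : fourierBasis.repr (toComplex f) n = coeff f n := by
  rw [fourierBasis_repr, fourierCoeff_congr_ae (toComplex_ae f)]
  rfl

lemma coeff_add (f g : L2) (n : ℤ) : coeff (f + g : L2) n = coeff f n + coeff g n := by
  simp only [← repr_toComplex, map_add, lp.coeFn_add, Pi.add_apply]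

lemma coeff_sub (f g : L2) (n : ℤ) : coeff (f - g : L2) n = coeff f n - coeff g n := by
  simp only [← repr_toComplex, map_sub, lp.coeFn_sub, Pi.sub_apply]

lemma coeff_zero (n : ℤ) : coeff (0 : L2) n = 0 := by
  simp only [← repr_toComplex, map_zero, lp.coeFn_zero, Pi.zero_apply]

lemma coeff_smul (r : ℝ) (f : L2) (n : ℤ) : coeff (r • f : L2) n = r * coeff f n := by
  have h : (r • f : L2) =ᵐ[torusMeasure] fun x => r * f x := Lp.coeFn_smul r f
  rw [coeff_congr h]
  unfold coeff
  rw [← fourierCoeff.const_mul]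
  simp only [Complex.ofReal_mul]

lemma coeff_neg_index (f : Torus → ℝ) (n : ℤ) :
    coeff f (-n) = (starRingEnd ℂ) (coeff f n) := by
  unfold coeff fourierCoeff
  rw [← integral_conj]
  refine integral_congr_ae (Eventually.of_forall fun x => ?_)
  simp only [smul_eq_mul, map_mul, Complex.conj_ofReal]
  rw [fourier_neg]

lemma inner_toComplex (f g : L2) :
    inner ℂ (toComplex f) (toComplex g) = ((inner ℝ f g : ℝ) : ℂ) := by
  rw [L2.inner_def, L2.inner_def, ← integral_complex_ofReal]
  refine integral_congr_ae ?_
  filter_upwards [toComplex_ae f, toComplex_ae g] with x h1 h2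
  rw [h1, h2]
  simp [mul_comm]

/-- Parseval's identity. -/
lemma hasSum_inner (f g : L2) :
    HasSum (fun n : ℤ => (coeff f n * (starRingEnd ℂ) (coeff g n)).re) (inner ℝ f g) := by
  have h := fourierBasis.hasSum_inner_mul_inner (toComplex f) (toComplex g)
  rw [inner_toComplex] at h
  have h2 := Complex.reCLM.hasSum h
  simp only [Complex.reCLM_apply, Complex.ofReal_re] at h2
  refine h2.congr_fun ?_
  intro n
  rw [← inner_conj_symm (toComplex f), ← HilbertBasis.repr_apply_apply,
    ← HilbertBasis.repr_apply_apply, repr_toComplex, repr_toComplex, ← Complex.conj_re]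
  simp

lemma hasSum_sq (f : L2) : HasSum (fun n : ℤ => ‖coeff f n‖ ^ 2) (‖f‖ ^ 2) := by
  have h := hasSum_inner f f
  rw [real_inner_self_eq_norm_sq] at h
  refine h.congr_fun fun n => ?_
  rw [Complex.mul_conj, Complex.ofReal_re, Complex.normSq_eq_norm_sq]

lemma ext_coeff {f g : L2} (h : ∀ n, coeff f n = coeff g n) : f = g := by
  have h1 := hasSum_sq (f - g)
  simp only [coeff_sub, h, sub_self] at h1
  have h3 : ‖f - g‖ = 0 := by simpa using h1.tsum_eq.symm
  exact sub_eq_zero.mp (norm_eq_zero.mp h3)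

lemma norm_coeff_le (f : L2) (n : ℤ) : ‖coeff f n‖ ≤ ‖f‖ := by
  have h := (hasSum_sq f)
  have h2 := h.tsum_eq ▸ h.summable.le_tsum n (fun j _ => by positivity)
  exact (sq_le_sq₀ (norm_nonneg _) (norm_nonneg _)).mp h2

/-- The coefficient sequences of real-valued square-integrable functions. -/
structure IsCoeffSeq (c : ℤ → ℂ) : Prop where
  summable : Summable fun n => ‖c n‖ ^ 2
  symm : ∀ n, c (-n) = (starRingEnd ℂ) (c n)

lemma coeff_ofCoeff {c : ℤ → ℂ} (hc : IsCoeffSeq c) (n : ℤ) : coeff (ofCoeff c) n = c n := by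
  have hmem : Memℓp c 2 := by
    rw [memℓp_gen_iff (by norm_num)]
    simpa using hc.summable
  set F : lp (fun _ : ℤ => ℂ) 2 := ⟨c, hmem⟩
  have hs := (fourierBasis (T := 2 * Real.pi)).hasSum_repr_symm F
  rw [coe_fourierBasis] at hs
  have hcoef : ∀ m, fourierCoeff (fourierBasis.repr.symm F : Lp ℂ 2 torusMeasure) m = c m := by
    intro m
    rw [← fourierBasis_repr]
    simp [F]
  set g : Lp ℂ 2 torusMeasure := fourierBasis.repr.symm F with hg
  have e1 : ofCoeff c = Complex.reCLM.compLp g := by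
    unfold ofCoeff
    rw [← hs.tsum_eq]
  have e2 : (fun x => ((ofCoeff c x : ℝ) : ℂ)) =ᵐ[torusMeasure]
      (1 / 2 : ℂ) • ((g : Torus → ℂ) + fun x => (starRingEnd ℂ) (g x)) := by
    rw [e1]
    filter_upwards [Complex.reCLM.coeFn_compLp g] with x hx
    rw [hx]
    simp only [Complex.reCLM_apply, Pi.smul_apply, Pi.add_apply, smul_eq_mul, Complex.add_conj]
    push_cast
    ring
  have hint : Integrable (g : Torus → ℂ) torusMeasure :=
    (Lp.memLp g).integrable (by norm_num)
  have hint' : Integrable (fun x => (starRingEnd ℂ) (g x)) torusMeasure :=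
    Complex.conjLIE.integrable_comp_iff.mpr hint
  have hconj : fourierCoeff (fun x => (starRingEnd ℂ) (g x)) n = (starRingEnd ℂ) (c (-n)) := by
    rw [← hcoef (-n)]
    unfold fourierCoeff
    rw [← integral_conj]
    refine integral_congr_ae (Eventually.of_forall fun x => ?_)
    simp only [smul_eq_mul, map_mul, neg_neg]
    rw [fourier_neg]
  unfold coeff
  rw [fourierCoeff_congr_ae e2, fourierCoeff.const_smul, fourierCoeff.add hint hint', Pi.add_apply,
    hcoef, hconj, hc.symm, Complex.conj_conj]
  simp only [smul_eq_mul]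
  ring

/-! ### Sobolev weights and the Bessel potential -/

/-- The weight `(1 + n²)^{s/2}`, so that `‖f‖_s` is the `ℓ²` norm of `wt s n * coeff f n`. -/
def wt (s : ℝ) (n : ℤ) : ℝ := (1 + (n : ℝ) ^ 2) ^ (s / 2)

lemma one_add_sq_pos (n : ℤ) : (0 : ℝ) < 1 + (n : ℝ) ^ 2 := by positivity

lemma wt_pos (s : ℝ) (n : ℤ) : 0 < wt s n := Real.rpow_pos_of_pos (one_add_sq_pos n) _

lemma wt_sq (s : ℝ) (n : ℤ) : wt s n ^ 2 = (1 + (n : ℝ) ^ 2) ^ s := by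
  rw [wt, ← Real.rpow_natCast, ← Real.rpow_mul (one_add_sq_pos n).le]
  congr 1
  push_cast
  ring

lemma wt_neg_index (s : ℝ) (n : ℤ) : wt s (-n) = wt s n := by simp [wt]

lemma wt_mul (s r : ℝ) (n : ℤ) : wt s n * wt r n = wt (s + r) n := by
  rw [wt, wt, wt, ← Real.rpow_add (one_add_sq_pos n)]
  congr 1
  ring

lemma wt_zero (n : ℤ) : wt 0 n = 1 := by simp [wt]

lemma wt_two (n : ℤ) : wt 2 n = 1 + (n : ℝ) ^ 2 := by simp [wt]

lemma wt_neg_mul (s : ℝ) (n : ℤ) : wt (-s) n * wt s n = 1 := by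
  rw [wt_mul, neg_add_cancel, wt_zero]

lemma wt_mono {s r : ℝ} (h : s ≤ r) (n : ℤ) : wt s n ≤ wt r n :=
  Real.rpow_le_rpow_of_exponent_le (by nlinarith [sq_nonneg (n : ℝ)]) (by linarith)

lemma abs_le_wt_one (n : ℤ) : |(n : ℝ)| ≤ wt 1 n := by
  refine abs_le_of_sq_le_sq ?_ (wt_pos 1 n).le
  rw [wt_sq, Real.rpow_one]
  linarith

/-- Peetre's inequality. -/
lemma wt_le_mul {s : ℝ} (hs : 0 ≤ s) (n k : ℤ) :
    wt s n ≤ 2 ^ (s / 2) * (wt s (n - k) * wt s k) := by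
  unfold wt
  rw [← Real.mul_rpow (one_add_sq_pos _).le (one_add_sq_pos _).le,
    ← Real.mul_rpow (by norm_num) (by positivity)]
  refine Real.rpow_le_rpow (one_add_sq_pos _).le ?_ (by linarith)
  push_cast
  nlinarith [sq_nonneg ((n : ℝ) - k - k), sq_nonneg (((n : ℝ) - k) * k)]

lemma memH_iff (s : ℝ) (f : L2) : MemH s f ↔ Summable fun n => ‖(wt s n : ℂ) * coeff f n‖ ^ 2 := by
  unfold MemH
  refine summable_congr fun n => ?_
  rw [norm_mul, mul_pow, Complex.norm_real, Real.norm_eq_abs, sq_abs, wt_sq, mul_comm]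

lemma normH_eq (s : ℝ) (f : L2) :
    normH s f = Real.sqrt (∑' n, ‖(wt s n : ℂ) * coeff f n‖ ^ 2) := by
  unfold normH
  congr 1
  refine tsum_congr fun n => ?_
  rw [norm_mul, mul_pow, Complex.norm_real, Real.norm_eq_abs, sq_abs, wt_sq, mul_comm]

lemma innerH_eq (s : ℝ) (f g : L2) :
    innerH s f g =
      ∑' n, ((wt s n * coeff f n) * (starRingEnd ℂ) (wt s n * coeff g n)).re := by
  unfold innerH
  refine tsum_congr fun n => ?_
  rw [← wt_sq, map_mul, Complex.conj_ofReal,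
    show (wt s n : ℂ) * coeff f n * (wt s n * (starRingEnd ℂ) (coeff g n)) =
      ((wt s n ^ 2 : ℝ) : ℂ) * (coeff f n * (starRingEnd ℂ) (coeff g n)) by push_cast; ring,
    Complex.re_ofReal_mul, mul_comm]

/-- The operator `(1 - ∂_x²)^{s/2}`, from `H^s` to `L²` (and with no meaning outside `H^s`). -/
def lift (s : ℝ) (f : L2) : L2 := ofCoeff fun n => wt s n * coeff f n

lemma isCoeffSeq_lift {s : ℝ} {f : L2} (h : MemH s f) :
    IsCoeffSeq fun n => wt s n * coeff f n where
  summable := (memH_iff s f).mp h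
  symm n := by rw [wt_neg_index, coeff_neg_index, map_mul, Complex.conj_ofReal]

lemma coeff_lift {s : ℝ} {f : L2} (h : MemH s f) (n : ℤ) :
    coeff (lift s f) n = wt s n * coeff f n :=
  coeff_ofCoeff (isCoeffSeq_lift h) n

lemma norm_lift {s : ℝ} {f : L2} (h : MemH s f) : ‖lift s f‖ = normH s f := by
  rw [normH_eq, ← Real.sqrt_sq (norm_nonneg (lift s f)), ← (hasSum_sq (lift s f)).tsum_eq]
  simp_rw [coeff_lift h]

lemma inner_lift {s : ℝ} {f g : L2} (hf : MemH s f) (hg : MemH s g) :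
    inner ℝ (lift s f) (lift s g) = innerH s f g := by
  rw [innerH_eq, ← (hasSum_inner _ _).tsum_eq]
  simp_rw [coeff_lift hf, coeff_lift hg]

lemma memH_sub {s : ℝ} {f g : L2} (hf : MemH s f) (hg : MemH s g) : MemH s (f - g) := by
  have h := (hasSum_sq (lift s f - lift s g)).summable
  rw [memH_iff]
  refine h.congr fun n => ?_
  rw [coeff_sub, coeff_sub, coeff_lift hf, coeff_lift hg, mul_sub]

lemma lift_sub {s : ℝ} {f g : L2} (hf : MemH s f) (hg : MemH s g) :
    lift s (f - g) = lift s f - lift s g := by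
  refine ext_coeff fun n => ?_
  rw [coeff_lift (memH_sub hf hg), coeff_sub, coeff_sub, coeff_lift hf, coeff_lift hg, mul_sub]

lemma lift_injective {s : ℝ} {f g : L2} (hf : MemH s f) (hg : MemH s g)
    (h : lift s f = lift s g) : f = g := by
  refine ext_coeff fun n => ?_
  have := coeff_lift hf n
  rw [h, coeff_lift hg n] at this
  exact (mul_left_cancel₀ (by exact_mod_cast (wt_pos s n).ne') this).symm

lemma memH_of_le {s r : ℝ} (h : s ≤ r) {f : L2} (hf : MemH r f) : MemH s f := by
  rw [memH_iff] at *
  refine Summable.of_nonneg_of_le (fun n => by positivity) (fun n => ?_) hf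
  simp only [norm_mul, Complex.norm_real, Real.norm_eq_abs, abs_of_pos (wt_pos _ _)]
  have := (wt_pos s n).le
  gcongr
  exact wt_mono h n

lemma memH_zero_index (f : L2) : MemH 0 f := by
  rw [memH_iff]
  simpa [wt_zero] using (hasSum_sq f).summable

lemma normH_mono {s r : ℝ} (h : s ≤ r) {f : L2} (hf : MemH r f) : normH s f ≤ normH r f := by
  rw [normH_eq, normH_eq]
  refine Real.sqrt_le_sqrt (Summable.tsum_le_tsum (fun n => ?_)
    ((memH_iff s f).mp (memH_of_le h hf)) ((memH_iff r f).mp hf))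
  simp only [norm_mul, Complex.norm_real, Real.norm_eq_abs, abs_of_pos (wt_pos _ _)]
  have := (wt_pos s n).le
  gcongr
  exact wt_mono h n

lemma normH_zero_index (f : L2) : normH 0 f = ‖f‖ := by
  rw [normH_eq, ← Real.sqrt_sq (norm_nonneg f), ← (hasSum_sq f).tsum_eq]
  simp [wt_zero]

lemma lift_zero_index (f : L2) : lift 0 f = f := by
  refine ext_coeff fun n => ?_
  rw [coeff_lift (memH_zero_index f), wt_zero, Complex.ofReal_one, one_mul]

lemma normH_nonneg (s : ℝ) (f : L2) : 0 ≤ normH s f := Real.sqrt_nonneg _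

lemma memH_zero (s : ℝ) : MemH s 0 := by
  rw [memH_iff]
  simp only [coeff_zero, mul_zero, norm_zero]
  exact (summable_zero (α := ℝ) (β := ℤ)).congr fun n => by norm_num

lemma lift_zero (s : ℝ) : lift s 0 = 0 := by
  refine ext_coeff fun n => ?_
  rw [coeff_lift (memH_zero s), coeff_zero, mul_zero]

lemma isCoeffSeq_bessel {s : ℝ} (hs : 0 ≤ s) (f : L2) :
    IsCoeffSeq fun n => wt (-s) n * coeff f n :=
  isCoeffSeq_lift (memH_of_le (neg_nonpos.mpr hs) (memH_zero_index f))

/-- The Bessel potential `(1 - ∂_x²)^{-s/2}` on `L²`, for `s ≥ 0`. -/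
def bessel (s : ℝ) (hs : 0 ≤ s) : L2 →L[ℝ] L2 :=
  LinearMap.mkContinuous
    { toFun := fun f => ofCoeff fun n => wt (-s) n * coeff f n
      map_add' := fun f g => by
        refine ext_coeff fun n => ?_
        rw [coeff_add, coeff_ofCoeff (isCoeffSeq_bessel hs _),
          coeff_ofCoeff (isCoeffSeq_bessel hs _), coeff_ofCoeff (isCoeffSeq_bessel hs _),
          coeff_add, mul_add]
      map_smul' := fun r f => by
        refine ext_coeff fun n => ?_
        rw [RingHom.id_apply, coeff_smul, coeff_ofCoeff (isCoeffSeq_bessel hs _),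
          coeff_ofCoeff (isCoeffSeq_bessel hs _), coeff_smul]
        ring } 1
    (fun f => by
      have h : MemH (-s) f := memH_of_le (neg_nonpos.mpr hs) (memH_zero_index f)
      have h2 : ‖lift (-s) f‖ ≤ ‖f‖ := by
        rw [norm_lift h, ← normH_zero_index f]
        exact normH_mono (neg_nonpos.mpr hs) (memH_zero_index f)
      simpa [lift] using h2)

section

variable {s : ℝ} (hs : 0 ≤ s)

lemma coeff_bessel (f : L2) (n : ℤ) : coeff (bessel s hs f) n = wt (-s) n * coeff f n :=
  coeff_ofCoeff (isCoeffSeq_bessel hs f) n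

lemma memH_bessel (f : L2) : MemH s (bessel s hs f) := by
  rw [memH_iff]
  refine (hasSum_sq f).summable.congr fun n => ?_
  rw [coeff_bessel, ← mul_assoc, ← Complex.ofReal_mul, mul_comm (wt s n), wt_neg_mul,
    Complex.ofReal_one, one_mul]

lemma lift_bessel (f : L2) : lift s (bessel s hs f) = f := by
  refine ext_coeff fun n => ?_
  rw [coeff_lift (memH_bessel hs f), coeff_bessel, ← mul_assoc, ← Complex.ofReal_mul,
    mul_comm (wt s n), wt_neg_mul, Complex.ofReal_one, one_mul]

lemma bessel_lift {f : L2} (hf : MemH s f) : bessel s hs (lift s f) = f :=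
  lift_injective (memH_bessel hs _) hf (lift_bessel hs _)

lemma bessel_injective : Function.Injective (bessel s hs) := fun f g h => by
  rw [← lift_bessel hs f, h, lift_bessel]

end

lemma memH_add {s : ℝ} {f g : L2} (hf : MemH s f) (hg : MemH s g) : MemH s (f + g) := by
  have h := (hasSum_sq (lift s f + lift s g)).summable
  rw [memH_iff]
  refine h.congr fun n => ?_
  rw [coeff_add, coeff_add, coeff_lift hf, coeff_lift hg, mul_add]

lemma lift_add {s : ℝ} {f g : L2} (hf : MemH s f) (hg : MemH s g) :
    lift s (f + g) = lift s f + lift s g := by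
  refine ext_coeff fun n => ?_
  rw [coeff_lift (memH_add hf hg), coeff_add, coeff_add, coeff_lift hf, coeff_lift hg, mul_add]

lemma memH_smul {s : ℝ} (r : ℝ) {f : L2} (hf : MemH s f) : MemH s (r • f) := by
  have h := (hasSum_sq (r • lift s f)).summable
  rw [memH_iff]
  refine h.congr fun n => ?_
  rw [coeff_smul, coeff_smul, coeff_lift hf, mul_left_comm]

lemma lift_smul {s : ℝ} (r : ℝ) {f : L2} (hf : MemH s f) : lift s (r • f) = r • lift s f := by
  refine ext_coeff fun n => ?_
  rw [coeff_lift (memH_smul r hf), coeff_smul, coeff_smul, coeff_lift hf, mul_left_comm]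

lemma normH_add_le {s : ℝ} {f g : L2} (hf : MemH s f) (hg : MemH s g) :
    normH s (f + g) ≤ normH s f + normH s g := by
  rw [← norm_lift hf, ← norm_lift hg, ← norm_lift (memH_add hf hg), lift_add hf hg]
  exact norm_add_le _ _

lemma normH_smul {s : ℝ} (r : ℝ) {f : L2} (hf : MemH s f) :
    normH s (r • f) = |r| * normH s f := by
  rw [← norm_lift hf, ← norm_lift (memH_smul r hf), lift_smul r hf, norm_smul, Real.norm_eq_abs]

/-! ### Products and the vector field -/

lemma integrable_mul (f g : L2) : Integrable (fun x => f x * g x) torusMeasure :=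
  (Lp.memLp f).integrable_mul (Lp.memLp g)

lemma integrable_L2 (f : L2) : Integrable (f : Torus → ℝ) torusMeasure :=
  (Lp.memLp f).integrable (by norm_num)

lemma coeff_fun_sub {F G : Torus → ℝ} (hF : Integrable F torusMeasure)
    (hG : Integrable G torusMeasure) (n : ℤ) :
    coeff (fun x => F x - G x) n = coeff F n - coeff G n := by
  unfold coeff fourierCoeff
  rw [← integral_sub (hF.ofReal.fourier_smul (-n)) (hG.ofReal.fourier_smul (-n))]
  refine integral_congr_ae (Eventually.of_forall fun x => ?_)
  simp only [smul_eq_mul, Complex.ofReal_sub, mul_sub]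

lemma coeff_fun_add {F G : Torus → ℝ} (hF : Integrable F torusMeasure)
    (hG : Integrable G torusMeasure) (n : ℤ) :
    coeff (fun x => F x + G x) n = coeff F n + coeff G n := by
  unfold coeff fourierCoeff
  rw [← integral_add (hF.ofReal.fourier_smul (-n)) (hG.ofReal.fourier_smul (-n))]
  refine integral_congr_ae (Eventually.of_forall fun x => ?_)
  simp only [smul_eq_mul, Complex.ofReal_add, mul_add]

/-- The Fourier coefficients of a product are the convolution of the coefficients. This is
Parseval's identity for the pair `conj (e_{-n} f)`, `g`. -/
lemma hasSum_coeff_mul (f g : L2) (n : ℤ) :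
    HasSum (fun k => coeff f (n - k) * coeff g k) (coeff (fun x => f x * g x) n) := by
  have hmem : MemLp (fun x => fourier n x * toComplex f x) 2 torusMeasure := by
    refine (Lp.memLp (toComplex f)).of_le ?_ (Eventually.of_forall fun x => ?_)
    · exact (map_continuous (fourier n)).aestronglyMeasurable.mul
        (Lp.aestronglyMeasurable _)
    · rw [norm_mul, fourier_apply, Circle.norm_coe, one_mul]
  set F : Lp ℂ 2 torusMeasure := hmem.toLp _ with hF
  have h := fourierBasis.hasSum_inner_mul_inner F (toComplex g)
  have e1 : inner ℂ F (toComplex g) = coeff (fun x => f x * g x) n := by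
    rw [L2.inner_def]
    unfold coeff fourierCoeff
    refine integral_congr_ae ?_
    filter_upwards [toComplex_ae f, toComplex_ae g, hmem.coeFn_toLp] with x h1 h2 h3
    rw [hF, h3, h1, h2, RCLike.inner_apply, map_mul, Complex.conj_ofReal, ← fourier_neg]
    simp only [smul_eq_mul, Complex.ofReal_mul]
    ring
  rw [e1] at h
  refine h.congr_fun fun k => ?_
  rw [← HilbertBasis.repr_apply_apply, repr_toComplex, coe_fourierBasis, L2.inner_def]
  congr 1
  unfold coeff fourierCoeff
  refine integral_congr_ae ?_
  filter_upwards [toComplex_ae f, hmem.coeFn_toLp, coeFn_fourierLp 2 k] with x h1 h2 h3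
  rw [hF, h2, h1, h3, RCLike.inner_apply, map_mul, Complex.conj_ofReal, ← fourier_neg,
    neg_sub, sub_eq_add_neg, fourier_add, smul_eq_mul]
  ring

lemma cauchy_schwarz_tsum {F G : ℤ → ℝ} (hF0 : ∀ n, 0 ≤ F n) (hG0 : ∀ n, 0 ≤ G n)
    (hF : Summable fun n => F n ^ 2) (hG : Summable fun n => G n ^ 2) :
    (Summable fun n => F n * G n) ∧
      ∑' n, F n * G n ≤ √(∑' n, F n ^ 2) * √(∑' n, G n ^ 2) := by
  have h : ∀ S : Finset ℤ, ∑ n ∈ S, F n * G n ≤ √(∑' n, F n ^ 2) * √(∑' n, G n ^ 2) := by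
    intro S
    refine (Real.sum_mul_le_sqrt_mul_sqrt S F G).trans ?_
    gcongr
    · exact hF.sum_le_tsum S fun n _ => sq_nonneg _
    · exact hG.sum_le_tsum S fun n _ => sq_nonneg _
  have hs := summable_of_sum_le (fun n => mul_nonneg (hF0 n) (hG0 n)) h
  exact ⟨hs, hs.tsum_le_of_sum_le h⟩

/-- Multiplication maps `H^s × H^s` into the sequences that are bounded for the weight of `H^s`:
the weight is submultiplicative along convolutions. -/
lemma wt_mul_norm_coeff_mul_le {s : ℝ} (hs : 0 ≤ s) {f g : L2} (hf : MemH s f) (hg : MemH s g)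
    (n : ℤ) : wt s n * ‖coeff (fun x => f x * g x) n‖ ≤
      2 ^ (s / 2) * (normH s f * normH s g) := by
  have hF := (memH_iff s f).mp hf
  have hG := (memH_iff s g).mp hg
  set F : ℤ → ℝ := fun k => ‖(wt s k : ℂ) * coeff f k‖
  set G : ℤ → ℝ := fun k => ‖(wt s k : ℂ) * coeff g k‖
  have hshift : ∑' k, F (n - k) ^ 2 = ∑' k, F k ^ 2 :=
    (Equiv.subLeft n).tsum_eq (fun k => F k ^ 2)
  obtain ⟨h1, h2⟩ := cauchy_schwarz_tsum (F := fun k => F (n - k)) (G := G)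
    (fun _ => norm_nonneg _) (fun _ => norm_nonneg _)
    ((Equiv.subLeft n).summable_iff.mpr hF) hG
  have h3 : ∀ k, ‖coeff f (n - k) * coeff g k‖ * wt s n ≤ 2 ^ (s / 2) * (F (n - k) * G k) := by
    intro k
    simp only [F, G, norm_mul, Complex.norm_real, Real.norm_eq_abs, abs_of_pos (wt_pos _ _)]
    calc ‖coeff f (n - k)‖ * ‖coeff g k‖ * wt s n
        ≤ ‖coeff f (n - k)‖ * ‖coeff g k‖ * (2 ^ (s / 2) * (wt s (n - k) * wt s k)) := by
          gcongr
          exact wt_le_mul hs n k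
      _ = _ := by ring
  have h4 : Summable fun k => ‖coeff f (n - k) * coeff g k‖ * wt s n :=
    Summable.of_nonneg_of_le (fun k => mul_nonneg (norm_nonneg _) (wt_pos _ _).le) h3
      (h1.mul_left _)
  have h5 : Summable fun k => ‖coeff f (n - k) * coeff g k‖ :=
    (summable_mul_right_iff (wt_pos s n).ne').mp h4
  calc wt s n * ‖coeff (fun x => f x * g x) n‖
      = ‖∑' k, coeff f (n - k) * coeff g k‖ * wt s n := by
        rw [(hasSum_coeff_mul f g n).tsum_eq, mul_comm]
    _ ≤ (∑' k, ‖coeff f (n - k) * coeff g k‖) * wt s n := by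
        have := (wt_pos s n).le
        gcongr
        exact norm_tsum_le_tsum_norm h5
    _ = ∑' k, ‖coeff f (n - k) * coeff g k‖ * wt s n := tsum_mul_right.symm
    _ ≤ ∑' k, 2 ^ (s / 2) * (F (n - k) * G k) := h4.tsum_le_tsum h3 (h1.mul_left _)
    _ = 2 ^ (s / 2) * ∑' k, F (n - k) * G k := tsum_mul_left
    _ ≤ 2 ^ (s / 2) * (normH s f * normH s g) := by
        rw [normH_eq, normH_eq]
        gcongr
        rw [← hshift]
        exact h2

lemma summable_wt_neg_one : Summable fun n : ℤ => wt (-1) n ^ 2 := by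
  refine Summable.of_norm_bounded_eventually (g := fun n : ℤ => 1 / (n : ℝ) ^ 2)
    (Real.summable_one_div_int_pow.mpr (by norm_num)) ?_
  filter_upwards [eventually_cofinite_ne (0 : ℤ)] with n hn
  rw [wt_sq, Real.rpow_neg_one, Real.norm_of_nonneg (by positivity), one_div]
  have : (0 : ℝ) < (n : ℝ) ^ 2 := by positivity
  gcongr
  linarith

/-- The `ℓ²` norm of the multiplier `(1 + n²)^{-1/2}`. -/
def resolventConst : ℝ := √(∑' n : ℤ, wt (-1) n ^ 2)

lemma resolventConst_nonneg : 0 ≤ resolventConst := Real.sqrt_nonneg _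

lemma wt_mul_norm_invHelmholtz_le {s M N : ℝ} {p q : ℤ → ℂ} (hp : ∀ n, wt s n * ‖p n‖ ≤ M)
    (hq : ∀ n, wt s n * ‖q n‖ ≤ N) (n : ℤ) :
    ‖(wt s n : ℂ) * invHelmholtz (p + ddx q) n‖ ≤ (M + N) * wt (-1) n := by
  have e : wt 1 n * wt 1 n = 1 + (n : ℝ) ^ 2 := by rw [wt_mul]; norm_num [wt_two]
  have e1 : ‖invHelmholtz (p + ddx q) n‖ = ‖p n + Complex.I * n * q n‖ / (wt 1 n * wt 1 n) := by
    rw [invHelmholtz, norm_div, e]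
    congr 1
    rw [show (1 + (n : ℂ) ^ 2) = ((1 + (n : ℝ) ^ 2 : ℝ) : ℂ) by push_cast; rfl,
      Complex.norm_real, Real.norm_of_nonneg (one_add_sq_pos n).le]
  have e2 : ‖p n + Complex.I * n * q n‖ ≤ wt 1 n * (‖p n‖ + ‖q n‖) := by
    refine (norm_add_le _ _).trans ?_
    have h1 : (1 : ℝ) ≤ wt 1 n := (wt_zero n).symm.le.trans (wt_mono zero_le_one n)
    have h2 := abs_le_wt_one n
    have h3 : ‖(n : ℂ)‖ = |(n : ℝ)| := by
      rw [← Complex.ofReal_intCast, Complex.norm_real, Real.norm_eq_abs]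
    rw [norm_mul, norm_mul, Complex.norm_I, one_mul, h3]
    nlinarith [norm_nonneg (p n), norm_nonneg (q n)]
  have hw := wt_pos 1 n
  have hw' := wt_pos s n
  have e3 : wt (-1) n = 1 / wt 1 n := by
    rw [eq_div_iff hw.ne', wt_neg_mul]
  rw [norm_mul, Complex.norm_real, Real.norm_of_nonneg hw'.le, e1, e3]
  calc wt s n * (‖p n + Complex.I * n * q n‖ / (wt 1 n * wt 1 n))
      ≤ wt s n * (wt 1 n * (‖p n‖ + ‖q n‖) / (wt 1 n * wt 1 n)) := by gcongr
    _ = (wt s n * ‖p n‖ + wt s n * ‖q n‖) * (1 / wt 1 n) := by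
        field_simp
    _ ≤ (M + N) * (1 / wt 1 n) := by
        gcongr
        · exact hp n
        · exact hq n

/-- `(1 - ∂_x²)⁻¹ (p + ∂_x q)` gains one derivative over `p` and `q`, which turns bounded sequences
into square-summable ones. -/
lemma memH_of_coeff_eq_invHelmholtz {s M N : ℝ} {p q : ℤ → ℂ} (hp : ∀ n, wt s n * ‖p n‖ ≤ M)
    (hq : ∀ n, wt s n * ‖q n‖ ≤ N) {f : L2} (hf : ∀ n, coeff f n = invHelmholtz (p + ddx q) n) :
    MemH s f ∧ normH s f ≤ resolventConst * (M + N) := by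
  have h0 : 0 ≤ M + N := add_nonneg
    ((mul_nonneg (wt_pos s 0).le (norm_nonneg _)).trans (hp 0))
    ((mul_nonneg (wt_pos s 0).le (norm_nonneg _)).trans (hq 0))
  have hle : ∀ n, ‖(wt s n : ℂ) * coeff f n‖ ^ 2 ≤ (M + N) ^ 2 * wt (-1) n ^ 2 := by
    intro n
    rw [← mul_pow, hf]
    exact pow_le_pow_left₀ (norm_nonneg _) (wt_mul_norm_invHelmholtz_le hp hq n) 2
  have hsum := Summable.of_nonneg_of_le (fun n => by positivity) hle
    (summable_wt_neg_one.mul_left _)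
  refine ⟨(memH_iff s f).mpr hsum, ?_⟩
  rw [mul_comm resolventConst, normH_eq, resolventConst]
  calc √(∑' n, ‖(wt s n : ℂ) * coeff f n‖ ^ 2)
      ≤ √((M + N) ^ 2 * ∑' n : ℤ, wt (-1) n ^ 2) := by
        refine Real.sqrt_le_sqrt ?_
        rw [← tsum_mul_left]
        exact hsum.tsum_le_tsum hle (summable_wt_neg_one.mul_left _)
    _ = (M + N) * √(∑' n : ℤ, wt (-1) n ^ 2) := by
        rw [Real.sqrt_mul (sq_nonneg _), Real.sqrt_sq h0]

/-! ### Smooth functions have rapidly decreasing coefficients -/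

lemma norm_coeff_le_integral (a : Torus → ℝ) (n : ℤ) :
    ‖coeff a n‖ ≤ ∫ x, ‖a x‖ ∂torusMeasure := by
  unfold coeff fourierCoeff
  refine (norm_integral_le_integral_norm _).trans_eq ?_
  refine integral_congr_ae (Eventually.of_forall fun x => ?_)
  simp only [smul_eq_mul, norm_mul, fourier_apply, Circle.norm_coe, one_mul, Complex.norm_real]

/-- The derivative of a smooth function on the torus, as a function on the torus. -/
lemma exists_deriv_torus {a : Torus → ℝ}
    (ha : ContDiff ℝ (⊤ : ℕ∞) (fun x : ℝ => a (x : Torus))) :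
    ∃ b : Torus → ℝ, ContDiff ℝ (⊤ : ℕ∞) (fun x : ℝ => b (x : Torus)) ∧
      ∀ x : ℝ, HasDerivAt (fun x : ℝ => a (x : Torus)) (b x) x := by
  have hper : Function.Periodic (deriv fun x : ℝ => a (x : Torus)) (2 * Real.pi) := by
    intro x
    rw [← deriv_comp_add_const]
    simp
  have hb : ∀ x : ℝ, hper.lift (x : Torus) = deriv (fun x : ℝ => a (x : Torus)) x :=
    fun x => rfl
  refine ⟨hper.lift, ?_, fun x => ?_⟩
  · simp only [hb]
    exact ((contDiff_infty_iff_deriv (𝕜 := ℝ)).mp ha).2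
  · rw [hb]
    exact (ha.differentiable (by simp) x).hasDerivAt

/-- Integration by parts; the boundary terms cancel by periodicity. -/
lemma coeff_deriv {a b : Torus → ℝ} (hb : Continuous fun x : ℝ => b (x : Torus))
    (hab : ∀ x : ℝ, HasDerivAt (fun x : ℝ => a (x : Torus)) (b x) x) (n : ℤ) :
    coeff b n = ddx (coeff a) n := by
  have hparts := intervalIntegral.integral_mul_deriv_eq_deriv_mul (a := 0) (b := 2 * Real.pi)
    (u := fun x : ℝ => (fourier (-n) (x : Torus) : ℂ))
    (v := fun x : ℝ => ((a (x : Torus) : ℝ) : ℂ)) (v' := fun x : ℝ => ((b (x : Torus) : ℝ) : ℂ))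
    (fun x _ => hasDerivAt_fourier_neg (2 * Real.pi) n x) (fun x _ => (hab x).ofReal_comp)
    (by
      refine Continuous.intervalIntegrable ?_ _ _
      exact continuous_const.mul ((map_continuous (fourier (-n))).comp
        (AddCircle.continuous_mk' _)))
    ((Complex.continuous_ofReal.comp hb).intervalIntegrable _ _)
  unfold ddx coeff
  rw [fourierCoeff_eq_intervalIntegral _ n 0, fourierCoeff_eq_intervalIntegral _ n 0, zero_add]
  simp only [smul_eq_mul] at hparts ⊢
  have h0 : ((2 * Real.pi : ℝ) : Torus) = ((0 : ℝ) : Torus) := by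
    simp
  rw [hparts, h0, sub_self, zero_sub]
  simp only [mul_assoc]
  rw [← intervalIntegral.integral_neg]
  simp only [Complex.real_smul, ← intervalIntegral.integral_const_mul]
  refine intervalIntegral.integral_congr fun x _ => ?_
  have : (Real.pi : ℂ) ≠ 0 := by exact_mod_cast Real.pi_ne_zero
  push_cast
  field_simp

lemma abs_pow_mul_norm_coeff_le (k : ℕ) : ∀ {a : Torus → ℝ},
    ContDiff ℝ (⊤ : ℕ∞) (fun x : ℝ => a (x : Torus)) →
      ∃ C, ∀ n : ℤ, |(n : ℝ)| ^ k * ‖coeff a n‖ ≤ C := by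
  induction k with
  | zero => exact fun {a} _ => ⟨_, fun n => by simpa using norm_coeff_le_integral a n⟩
  | succ k ih =>
    intro a ha
    obtain ⟨b, hb, hab⟩ := exists_deriv_torus ha
    obtain ⟨C, hC⟩ := ih hb
    refine ⟨C, fun n => ?_⟩
    refine le_of_eq_of_le ?_ (hC n)
    rw [coeff_deriv hb.continuous hab, ddx, norm_mul, norm_mul, Complex.norm_I, one_mul,
      ← Complex.ofReal_intCast, Complex.norm_real, Real.norm_eq_abs]
    ring

lemma wt_mul_norm_coeff_bounded {a : Torus → ℝ}
    (ha : ContDiff ℝ (⊤ : ℕ∞) (fun x : ℝ => a (x : Torus))) (s : ℝ) :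
    ∃ C, ∀ n : ℤ, wt s n * ‖coeff a n‖ ≤ C := by
  obtain ⟨m, hm⟩ := exists_nat_ge (s / 2)
  obtain ⟨C₀, h₀⟩ := abs_pow_mul_norm_coeff_le 0 ha
  obtain ⟨C, hC⟩ := abs_pow_mul_norm_coeff_le (2 * m) ha
  refine ⟨2 ^ m * (C₀ + C), fun n => ?_⟩
  have h1 : wt s n ≤ 2 ^ m * (1 + |(n : ℝ)| ^ (2 * m)) := by
    calc wt s n ≤ (1 + (n : ℝ) ^ 2) ^ (m : ℝ) :=
          Real.rpow_le_rpow_of_exponent_le (by nlinarith [sq_nonneg (n : ℝ)]) hm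
      _ = (1 + (n : ℝ) ^ 2) ^ m := Real.rpow_natCast _ _
      _ ≤ (2 ^ (m - 1)) * (1 ^ m + ((n : ℝ) ^ 2) ^ m) :=
          add_pow_le zero_le_one (sq_nonneg _) m
      _ ≤ 2 ^ m * (1 + |(n : ℝ)| ^ (2 * m)) := by
          rw [one_pow, pow_mul, sq_abs]
          gcongr
          · norm_num
          · omega
  calc wt s n * ‖coeff a n‖ ≤ 2 ^ m * (1 + |(n : ℝ)| ^ (2 * m)) * ‖coeff a n‖ := by gcongr
    _ = 2 ^ m * (|(n : ℝ)| ^ 0 * ‖coeff a n‖ + |(n : ℝ)| ^ (2 * m) * ‖coeff a n‖) := by ring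
    _ ≤ 2 ^ m * (C₀ + C) := by
        gcongr
        · exact h₀ n
        · exact hC n

lemma continuous_of_contDiff {a : Torus → ℝ}
    (ha : ContDiff ℝ (⊤ : ℕ∞) (fun x : ℝ => a (x : Torus))) : Continuous a :=
  (QuotientAddGroup.isQuotientMap_mk (N := AddSubgroup.zmultiples (2 * Real.pi))).continuous_iff.mpr
    ha.continuous

/-- A smooth function belongs to every `H^s`. -/
lemma exists_memH_of_contDiff {a : Torus → ℝ}
    (ha : ContDiff ℝ (⊤ : ℕ∞) (fun x : ℝ => a (x : Torus))) :
    ∃ A : L2, A =ᵐ[torusMeasure] a ∧ ∀ s, MemH s A := by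
  have hm : MemLp a 2 torusMeasure :=
    (continuous_of_contDiff ha).memLp_of_hasCompactSupport
      (HasCompactSupport.of_compactSpace _)
  refine ⟨hm.toLp a, hm.coeFn_toLp, fun s => ?_⟩
  obtain ⟨C, hC⟩ := wt_mul_norm_coeff_bounded ha (s + 1)
  rw [memH_iff]
  refine Summable.of_nonneg_of_le (fun n => by positivity) (fun n => ?_)
    (summable_wt_neg_one.mul_left (C ^ 2))
  rw [coeff_congr hm.coeFn_toLp, ← mul_pow, norm_mul, Complex.norm_real,
    Real.norm_of_nonneg (wt_pos s n).le]
  refine pow_le_pow_left₀ (mul_nonneg (wt_pos s n).le (norm_nonneg _)) ?_ 2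
  calc wt s n * ‖coeff a n‖ = (wt (s + 1) n * ‖coeff a n‖) * wt (-1) n := by
        have := wt_mul (s + 1) (-1) n
        rw [show s + 1 + -1 = s by ring] at this
        rw [← this]
        ring
    _ ≤ C * wt (-1) n := mul_le_mul_of_nonneg_right (hC n) (wt_pos _ _).le

/-! ### The vector field is quadratically bounded and locally Lipschitz on `H^s` -/

/-- The constant function `1`. -/
def oneL2 : L2 := (memLp_const (1 : ℝ)).toLp _

lemma oneL2_ae : oneL2 =ᵐ[torusMeasure] fun _ => (1 : ℝ) := MemLp.coeFn_toLp _

lemma memH_oneL2 (s : ℝ) : MemH s oneL2 := by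
  obtain ⟨A, hA, hAs⟩ := exists_memH_of_contDiff (a := fun _ => 1) contDiff_const
  rw [show oneL2 = A from Lp.ext (oneL2_ae.trans hA.symm)]
  exact hAs s

/-- The factor `1 + u/2` in `u + u²/2 = u (1 + u/2)`. -/
def fluxFactor (u : L2) : L2 := oneL2 + (1 / 2 : ℝ) • u

lemma fluxFactor_ae (u : L2) : fluxFactor u =ᵐ[torusMeasure] fun x => 1 + u x / 2 := by
  filter_upwards [Lp.coeFn_add oneL2 ((1 / 2 : ℝ) • u), Lp.coeFn_smul (1 / 2 : ℝ) u, oneL2_ae]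
    with x h1 h2 h3
  rw [fluxFactor, h1, Pi.add_apply, h2, h3, Pi.smul_apply, smul_eq_mul]
  ring

lemma memH_fluxFactor {s : ℝ} {u : L2} (hu : MemH s u) : MemH s (fluxFactor u) :=
  memH_add (memH_oneL2 s) (memH_smul _ hu)

lemma normH_fluxFactor_le {s : ℝ} {u : L2} (hu : MemH s u) :
    normH s (fluxFactor u) ≤ normH s oneL2 + normH s u / 2 := by
  refine (normH_add_le (memH_oneL2 s) (memH_smul _ hu)).trans_eq ?_
  rw [normH_smul _ hu, abs_of_pos (by norm_num)]
  ring

lemma coeff_flux (u : L2) :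
    coeff (fun x => u x + u x ^ 2 / 2) = coeff fun x => u x * fluxFactor u x := by
  refine coeff_congr ?_
  filter_upwards [fluxFactor_ae u] with x hx
  rw [hx]
  ring

lemma coeff_damping {a : Torus → ℝ} {A : L2} (hA : A =ᵐ[torusMeasure] a) (u : L2) :
    coeff (fun x => a x * u x) = coeff fun x => A x * u x := by
  refine coeff_congr ?_
  filter_upwards [hA] with x hx
  rw [hx]

lemma norm_coeff_mul_le (f g : L2) (n : ℤ) :
    ‖coeff (fun x => f x * g x) n‖ ≤ ‖f‖ * ‖g‖ := by
  simpa [wt_zero, normH_zero_index] using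
    wt_mul_norm_coeff_mul_le le_rfl (memH_zero_index f) (memH_zero_index g) n

lemma coeff_field {a : Torus → ℝ} {A : L2} (hA : A =ᵐ[torusMeasure] a) (u : L2) (n : ℤ) :
    coeff (field a u) n = invHelmholtz ((coeff fun x => A x * u x) +
      ddx (coeff fun x => u x * fluxFactor u x)) n := by
  unfold field
  rw [coeff_flux, coeff_damping hA]
  refine coeff_ofCoeff ⟨?_, fun n => ?_⟩ n
  · refine Summable.of_nonneg_of_le (fun n => by positivity) (fun n => ?_)
      (summable_wt_neg_one.mul_left ((‖A‖ * ‖u‖ + ‖u‖ * ‖fluxFactor u‖) ^ 2))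
    rw [← mul_pow]
    refine pow_le_pow_left₀ (norm_nonneg _) ?_ 2
    have := wt_mul_norm_invHelmholtz_le (s := 0) (M := ‖A‖ * ‖u‖) (N := ‖u‖ * ‖fluxFactor u‖)
      (p := coeff fun x => A x * u x) (q := coeff fun x => u x * fluxFactor u x)
      (fun n => by simpa [wt_zero] using norm_coeff_mul_le A u n)
      (fun n => by simpa [wt_zero] using norm_coeff_mul_le u (fluxFactor u) n) n
    simpa [wt_zero] using this
  · simp only [invHelmholtz, ddx, Pi.add_apply, coeff_neg_index, map_div₀, map_add, map_mul,
      Complex.conj_I, map_one, map_pow, map_intCast]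
    push_cast
    ring

/-- The difference of two values of the field is again of the form `(1 - ∂_x²)⁻¹ (p + ∂_x q)`, with
`p` and `q` products that contain the factor `u - w`. -/
lemma coeff_field_sub {a : Torus → ℝ} {A : L2} (hA : A =ᵐ[torusMeasure] a) (u w : L2) (n : ℤ) :
    coeff (field a u - field a w : L2) n =
      invHelmholtz ((coeff fun x => A x * (u - w : L2) x) +
        ddx (coeff fun x => (u - w : L2) x * fluxFactor (u + w) x)) n := by
  have h1 : coeff (fun x => A x * (u - w : L2) x) n =
      coeff (fun x => A x * u x) n - coeff (fun x => A x * w x) n := by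
    rw [← coeff_fun_sub (integrable_mul _ _) (integrable_mul _ _)]
    refine congrFun (coeff_congr ?_) n
    filter_upwards [Lp.coeFn_sub u w] with x hx
    rw [hx, Pi.sub_apply, mul_sub]
  have h2 : coeff (fun x => (u - w : L2) x * fluxFactor (u + w) x) n =
      coeff (fun x => u x * fluxFactor u x) n - coeff (fun x => w x * fluxFactor w x) n := by
    rw [← coeff_fun_sub (integrable_mul _ _) (integrable_mul _ _)]
    refine congrFun (coeff_congr ?_) n
    filter_upwards [Lp.coeFn_sub u w, Lp.coeFn_add u w, fluxFactor_ae u, fluxFactor_ae w,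
      fluxFactor_ae (u + w)] with x e1 e2 e3 e4 e5
    rw [e5, e4, e3, e2, e1, Pi.sub_apply, Pi.add_apply]
    ring
  rw [coeff_sub, coeff_field hA, coeff_field hA]
  simp only [invHelmholtz, ddx, Pi.add_apply, h1, h2]
  ring

lemma field_zero (a : Torus → ℝ) : field a 0 = 0 := by
  have h1 : coeff (fun x => a x * (0 : L2) x) = 0 := by
    funext n
    rw [Pi.zero_apply, ← coeff_zero n]
    refine congrFun (coeff_congr ?_) n
    filter_upwards [Lp.coeFn_zero ℝ 2 torusMeasure] with x hx
    rw [hx, Pi.zero_apply, mul_zero]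
  have h2 : coeff (fun x => (0 : L2) x + (0 : L2) x ^ 2 / 2) = 0 := by
    funext n
    rw [Pi.zero_apply, ← coeff_zero n]
    refine congrFun (coeff_congr ?_) n
    filter_upwards [Lp.coeFn_zero ℝ 2 torusMeasure] with x hx
    rw [hx, Pi.zero_apply]
    norm_num
  have h3 : IsCoeffSeq (0 : ℤ → ℂ) :=
    ⟨(summable_zero (α := ℝ) (β := ℤ)).congr fun n => by norm_num, by simp⟩
  refine ext_coeff fun n => ?_
  unfold field
  rw [h1, h2, coeff_zero, show invHelmholtz (0 + ddx 0) = 0 by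
    funext n; simp [invHelmholtz, ddx], coeff_ofCoeff h3, Pi.zero_apply]

lemma memH_field_sub {a : Torus → ℝ} {A : L2} (hA : A =ᵐ[torusMeasure] a) {s : ℝ} (hs : 0 ≤ s)
    (hAs : MemH s A) {u w : L2} (hu : MemH s u) (hw : MemH s w) :
    MemH s (field a u - field a w) ∧ normH s (field a u - field a w) ≤
      resolventConst * (2 ^ (s / 2) * (normH s A * normH s (u - w)) +
        2 ^ (s / 2) * (normH s (u - w) * normH s (fluxFactor (u + w)))) :=
  memH_of_coeff_eq_invHelmholtz
    (wt_mul_norm_coeff_mul_le hs hAs (memH_sub hu hw))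
    (wt_mul_norm_coeff_mul_le hs (memH_sub hu hw) (memH_fluxFactor (memH_add hu hw)))
    (coeff_field_sub hA u w)

lemma memH_field {a : Torus → ℝ} {A : L2} (hA : A =ᵐ[torusMeasure] a) {s : ℝ} (hs : 0 ≤ s)
    (hAs : MemH s A) {u : L2} (hu : MemH s u) : MemH s (field a u) := by
  simpa [field_zero] using (memH_field_sub hA hs hAs hu (memH_zero s)).1

/-- A vector field that vanishes at the origin and whose Lipschitz constants grow at most
linearly. -/
def QuadraticLipschitz {E : Type*} [NormedAddCommGroup E] (C : ℝ) (G : E → E) : Prop :=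
  0 ≤ C ∧ G 0 = 0 ∧ ∀ x y, ‖G x - G y‖ ≤ C * (1 + ‖x‖ + ‖y‖) * ‖x - y‖

/-- The vector field of the equation for the unknown `z = (1 - ∂_x²)^{s/2} u`: a field on `L²`
that represents the action of `field a` on `H^s`. -/
def stateField (a : Torus → ℝ) (s : ℝ) (hs : 0 ≤ s) (z : L2) : L2 :=
  lift s (field a (bessel s hs z))

lemma bessel_stateField {a : Torus → ℝ} {A : L2} (hA : A =ᵐ[torusMeasure] a) {s : ℝ} (hs : 0 ≤ s)
    (hAs : MemH s A) (z : L2) :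
    bessel s hs (stateField a s hs z) = field a (bessel s hs z) :=
  bessel_lift hs (memH_field hA hs hAs (memH_bessel hs z))

lemma normH_bessel {s : ℝ} (hs : 0 ≤ s) (z : L2) : normH s (bessel s hs z) = ‖z‖ := by
  rw [← norm_lift (memH_bessel hs z), lift_bessel]

lemma quadraticLipschitz_stateField {a : Torus → ℝ} {A : L2} (hA : A =ᵐ[torusMeasure] a) {s : ℝ}
    (hs : 0 ≤ s) (hAs : MemH s A) : ∃ C, QuadraticLipschitz C (stateField a s hs) := by
  set M : ℝ := normH s A + normH s oneL2 + 1 with hM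
  have hA0 := normH_nonneg s A
  have h10 := normH_nonneg s oneL2
  have hr := resolventConst_nonneg
  refine ⟨resolventConst * (2 ^ (s / 2) * M), by positivity, ?_, fun x y => ?_⟩
  · rw [stateField, map_zero, field_zero, lift_zero]
  set u := bessel s hs x with hu
  set w := bessel s hs y with hw
  have hus : MemH s u := memH_bessel hs x
  have hws : MemH s w := memH_bessel hs y
  have hd : normH s (u - w) = ‖x - y‖ := by rw [hu, hw, ← map_sub, normH_bessel]
  have hf : normH s (fluxFactor (u + w)) ≤ normH s oneL2 + (‖x‖ + ‖y‖) := by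
    refine (normH_fluxFactor_le (memH_add hus hws)).trans ?_
    have h1 : normH s (u + w) ≤ ‖x‖ + ‖y‖ := by
      rw [hu, hw, ← map_add, normH_bessel]
      exact norm_add_le _ _
    have := normH_nonneg s (u + w)
    linarith
  obtain ⟨hm, hle⟩ := memH_field_sub hA hs hAs hus hws
  rw [stateField, stateField, ← lift_sub (memH_field hA hs hAs hus) (memH_field hA hs hAs hws),
    norm_lift hm]
  refine hle.trans ?_
  rw [hd, mul_assoc, mul_assoc, ← mul_add, mul_assoc]
  gcongr
  have hx := norm_nonneg x
  have hy := norm_nonneg y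
  calc normH s A * ‖x - y‖ + ‖x - y‖ * normH s (fluxFactor (u + w))
      = (normH s A + normH s (fluxFactor (u + w))) * ‖x - y‖ := by ring
    _ ≤ (M * (1 + ‖x‖ + ‖y‖)) * ‖x - y‖ := by
        gcongr
        nlinarith
    _ = _ := by ring

/-! ### Ordinary differential equations with a quadratically bounded field -/

section ODE

variable {E : Type*} [NormedAddCommGroup E] {G : E → E} {C R T : ℝ}

lemma QuadraticLipschitz.norm_le (hG : QuadraticLipschitz C G) {x : E} (hx : ‖x‖ ≤ R) :
    ‖G x‖ ≤ C * (1 + R) * R := by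
  have h := hG.2.2 x 0
  rw [hG.2.1, sub_zero, sub_zero, norm_zero, add_zero] at h
  have := hG.1
  have hR : 0 ≤ R := (norm_nonneg _).trans hx
  exact h.trans (by gcongr)

lemma QuadraticLipschitz.lipschitzOnWith (hG : QuadraticLipschitz C G) (R : ℝ) :
    LipschitzOnWith (C * (1 + 2 * R)).toNNReal G (Metric.closedBall 0 R) := by
  refine LipschitzOnWith.of_dist_le_mul fun x hx y hy => ?_
  rw [mem_closedBall_zero_iff] at hx hy
  rw [dist_eq_norm, dist_eq_norm]
  refine (hG.2.2 x y).trans ?_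
  gcongr
  refine le_trans ?_ (Real.le_coe_toNNReal _)
  exact mul_le_mul_of_nonneg_left (by linarith) hG.1

lemma QuadraticLipschitz.continuous (hG : QuadraticLipschitz C G) : Continuous G := by
  rw [continuous_iff_continuousAt]
  intro x
  refine ((hG.lipschitzOnWith (‖x‖ + 1)).continuousOn).continuousAt ?_
  refine Filter.mem_of_superset (Metric.ball_mem_nhds x one_pos) fun y hy => ?_
  rw [mem_closedBall_zero_iff]
  rw [mem_ball_iff_norm] at hy
  linarith [norm_le_norm_add_norm_sub' y x]

variable [NormedSpace ℝ E] {z₀ w₀ : E} {z w : ℝ → E}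

/-- `z` is a continuous solution on `[0,T]` of the integral equation of `z' = -G(z)`,
`z(0) = z₀`. -/
def IsIntegralSolution (G : E → E) (T : ℝ) (z₀ : E) (z : ℝ → E) : Prop :=
  ContinuousOn z (Set.Icc 0 T) ∧ ∀ t ∈ Set.Icc 0 T, z t = z₀ - ∫ τ in (0 : ℝ)..t, G (z τ)

lemma IsIntegralSolution.mono (hz : IsIntegralSolution G T z₀ z) {S : ℝ} (h : S ≤ T) :
    IsIntegralSolution G S z₀ z :=
  ⟨hz.1.mono (Set.Icc_subset_Icc_right h), fun t ht => hz.2 t ⟨ht.1, ht.2.trans h⟩⟩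

lemma IsIntegralSolution.initial (hz : IsIntegralSolution G T z₀ z) (hT : 0 ≤ T) :
    z 0 = z₀ := by
  simpa using hz.2 0 ⟨le_rfl, hT⟩

lemma IsIntegralSolution.intervalIntegrable (hG : Continuous G)
    (hz : IsIntegralSolution G T z₀ z) {s t : ℝ} (hs : s ∈ Set.Icc 0 T) (ht : t ∈ Set.Icc 0 T) :
    IntervalIntegrable (fun τ => G (z τ)) volume s t :=
  ((hG.comp_continuousOn hz.1).mono (Set.uIcc_subset_Icc hs ht)).intervalIntegrable

/-- Translation in time of an autonomous equation. -/
lemma IsIntegralSolution.shift (hG : Continuous G) {t₀ : ℝ} (ht₀ : 0 ≤ t₀) (hT : 0 ≤ T)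
    (hz : IsIntegralSolution G (t₀ + T) z₀ z) :
    IsIntegralSolution G T (z t₀) fun τ => z (t₀ + τ) := by
  refine ⟨hz.1.comp (by fun_prop) fun τ hτ => ⟨add_nonneg ht₀ hτ.1, by linarith [hτ.2]⟩,
    fun t ht => ?_⟩
  have h0 : (0 : ℝ) ∈ Set.Icc 0 (t₀ + T) := ⟨le_rfl, by linarith⟩
  have h1 : t₀ ∈ Set.Icc 0 (t₀ + T) := ⟨ht₀, by linarith⟩
  have h2 : t₀ + t ∈ Set.Icc 0 (t₀ + T) := ⟨add_nonneg ht₀ ht.1, by linarith [ht.2]⟩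
  beta_reduce
  rw [hz.2 _ h1, hz.2 _ h2, intervalIntegral.integral_comp_add_left (fun τ => G (z τ)), add_zero,
    ← intervalIntegral.integral_add_adjacent_intervals (hz.intervalIntegrable hG h0 h1)
      (hz.intervalIntegrable hG h1 h2)]
  abel

lemma IsIntegralSolution.bounded (hz : IsIntegralSolution G T z₀ z) :
    ∃ R, ∀ t ∈ Set.Icc 0 T, ‖z t‖ ≤ R :=
  isCompact_Icc.exists_bound_of_continuousOn hz.1

/-- The radial retraction of a normed space onto the closed ball of radius `R > 0`. -/
def radialRetraction (R : ℝ) (x : E) : E := (R / max R ‖x‖) • x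

lemma radialRetraction_of_le (hR : 0 < R) {x : E} (hx : ‖x‖ ≤ R) : radialRetraction R x = x := by
  rw [radialRetraction, max_eq_left hx, div_self hR.ne', one_smul]

lemma norm_radialRetraction_le (hR : 0 < R) (x : E) : ‖radialRetraction R x‖ ≤ R := by
  have hm : 0 < max R ‖x‖ := lt_max_of_lt_left hR
  rw [radialRetraction, norm_smul, Real.norm_of_nonneg (by positivity), div_mul_eq_mul_div,
    div_le_iff₀ hm]
  gcongr
  exact le_max_right _ _

lemma lipschitzWith_radialRetraction (hR : 0 < R) :
    LipschitzWith 2 (radialRetraction R : E → E) := by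
  refine LipschitzWith.of_dist_le_mul fun x y => ?_
  rw [dist_eq_norm, dist_eq_norm]
  set p := max R ‖x‖ with hp
  set q := max R ‖y‖ with hq
  have hp0 : 0 < p := lt_max_of_lt_left hR
  have hq0 : 0 < q := lt_max_of_lt_left hR
  have hpR : R / p ≤ 1 := (div_le_one hp0).mpr (le_max_left _ _)
  have hpq : |q - p| ≤ ‖x - y‖ := by
    have h := abs_max_sub_max_le_abs ‖y‖ ‖x‖ R
    rw [max_comm ‖y‖, max_comm ‖x‖] at h
    exact h.trans ((abs_norm_sub_norm_le y x).trans_eq (norm_sub_rev _ _))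
  have e : radialRetraction R x - radialRetraction R y =
      (R / p) • (x - y) + ((R / p) * ((q - p) / q)) • y := by
    have : (R / p) * ((q - p) / q) = R / p - R / q := by field_simp
    rw [this, radialRetraction, radialRetraction, smul_sub, sub_smul]
    abel
  have hyq : ‖y‖ / q ≤ 1 := (div_le_one hq0).mpr (le_max_right _ _)
  rw [e]
  refine (norm_add_le _ _).trans ?_
  rw [norm_smul, norm_smul, norm_mul, norm_div, norm_div (q - p), Real.norm_of_nonneg hR.le,
    Real.norm_of_nonneg hp0.le, Real.norm_of_nonneg hq0.le, Real.norm_eq_abs]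
  have e2 : R / p * (|q - p| / q) * ‖y‖ = (R / p) * (|q - p| * (‖y‖ / q)) := by ring
  rw [e2]
  have h0 : 0 ≤ R / p := by positivity
  calc R / p * ‖x - y‖ + R / p * (|q - p| * (‖y‖ / q))
      ≤ 1 * ‖x - y‖ + 1 * (‖x - y‖ * 1) := by gcongr
    _ = ((2 : NNReal) : ℝ) * ‖x - y‖ := by push_cast; ring

/-- The field `G` made bounded and globally Lipschitz, with the same values on the ball. -/
def truncatedField (G : E → E) (R : ℝ) (x : E) : E := G (radialRetraction R x)

lemma QuadraticLipschitz.continuous_truncatedField (hG : QuadraticLipschitz C G) (hR : 0 < R) :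
    Continuous (truncatedField G R) :=
  hG.continuous.comp (lipschitzWith_radialRetraction hR).continuous

/-- A solution of the truncated equation that remains in the ball solves the equation. -/
lemma IsIntegralSolution.of_truncatedField (hR : 0 < R)
    (hz : IsIntegralSolution (truncatedField G R) T z₀ z) (h : ∀ t ∈ Set.Icc 0 T, ‖z t‖ ≤ R) :
    IsIntegralSolution G T z₀ z := by
  refine ⟨hz.1, fun t ht => ?_⟩
  rw [hz.2 t ht]
  congr 1
  refine intervalIntegral.integral_congr fun τ hτ => ?_
  rw [truncatedField, radialRetraction_of_le hR]
  exact h τ (Set.uIcc_subset_Icc ⟨le_rfl, ht.1.trans ht.2⟩ ht hτ)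

variable [CompleteSpace E]

lemma IsIntegralSolution.hasDerivWithinAt (hG : Continuous G) (hz : IsIntegralSolution G T z₀ z)
    {t : ℝ} (ht : t ∈ Set.Icc 0 T) : HasDerivWithinAt z (-G (z t)) (Set.Icc 0 T) t := by
  have h0 : (0 : ℝ) ∈ Set.Icc 0 T := ⟨le_rfl, ht.1.trans ht.2⟩
  have h := ODE.hasDerivWithinAt_picard_Icc (f := fun _ x => -G x) (u := Set.univ) h0
    (by fun_prop) hz.1 (fun _ _ => Set.mem_univ _) z₀ ht
  refine h.congr_of_mem (fun τ hτ => ?_) ht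
  rw [ODE.picard_apply, hz.2 τ hτ, intervalIntegral.integral_neg, sub_eq_add_neg]

/-- Grönwall's estimate for two solutions that remain in a common ball. -/
lemma IsIntegralSolution.norm_sub_le (hG : QuadraticLipschitz C G)
    (hz : IsIntegralSolution G T z₀ z) (hw : IsIntegralSolution G T w₀ w)
    (hzR : ∀ t ∈ Set.Icc 0 T, ‖z t‖ ≤ R) (hwR : ∀ t ∈ Set.Icc 0 T, ‖w t‖ ≤ R)
    {t : ℝ} (ht : t ∈ Set.Icc 0 T) :
    ‖z t - w t‖ ≤ ‖z₀ - w₀‖ * Real.exp (C * (1 + 2 * R) * t) := by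
  have hR : 0 ≤ R := (norm_nonneg _).trans (hzR t ht)
  have hT : 0 ≤ T := ht.1.trans ht.2
  have hK : 0 ≤ C * (1 + 2 * R) := mul_nonneg hG.1 (by linarith)
  have hd : ∀ {y : ℝ → E} {y₀ : E}, IsIntegralSolution G T y₀ y → ∀ t ∈ Set.Ico 0 T,
      HasDerivWithinAt y (-G (y t)) (Set.Ici t) t := fun hy t ht =>
    ((hy.hasDerivWithinAt hG.continuous (Set.Ico_subset_Icc_self ht)).mono
      (Set.Icc_subset_Icc_left ht.1)).mono_of_mem_nhdsWithin (Icc_mem_nhdsGE ht.2)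
  have h := dist_le_of_trajectories_ODE_of_mem (v := fun _ x => -G x)
    (s := fun _ => Metric.closedBall (0 : E) R) (δ := ‖z₀ - w₀‖) (a := 0) (b := T)
    (fun t _ => (hG.lipschitzOnWith R).neg) hz.1 (hd hz)
    (fun t ht => mem_closedBall_zero_iff.mpr (hzR t (Set.Ico_subset_Icc_self ht))) hw.1 (hd hw)
    (fun t ht => mem_closedBall_zero_iff.mpr (hwR t (Set.Ico_subset_Icc_self ht)))
    (by rw [hz.initial hT, hw.initial hT, dist_eq_norm]) t ht
  rwa [dist_eq_norm, Real.coe_toNNReal _ hK, sub_zero] at h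

lemma IsIntegralSolution.eqOn (hG : QuadraticLipschitz C G)
    (hz : IsIntegralSolution G T z₀ z) (hw : IsIntegralSolution G T z₀ w) :
    Set.EqOn z w (Set.Icc 0 T) := by
  intro t ht
  obtain ⟨R, hR⟩ := hz.bounded
  obtain ⟨R', hR'⟩ := hw.bounded
  have h := hz.norm_sub_le hG hw (R := max R R') (fun t ht => (hR t ht).trans (le_max_left _ _))
    (fun t ht => (hR' t ht).trans (le_max_right _ _)) ht
  rw [sub_self, norm_zero, zero_mul] at h
  exact sub_eq_zero.mp (norm_le_zero_iff.mp h)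

/-- The truncated field is bounded and globally Lipschitz, so the Picard iteration converges on
any time interval. -/
lemma QuadraticLipschitz.exists_truncated_solution (hG : QuadraticLipschitz C G) (hR : 0 < R)
    (hT : 0 ≤ T) (z₀ : E) : ∃ z, IsIntegralSolution (truncatedField G R) T z₀ z := by
  have hL : 0 ≤ C * (1 + R) * R := mul_nonneg (mul_nonneg hG.1 (by linarith)) hR.le
  have hlip : ∀ s : Set E,
      LipschitzOnWith ((C * (1 + 2 * R)).toNNReal * 2) (fun x => -truncatedField G R x) s :=
    fun s => LipschitzOnWith.neg ((hG.lipschitzOnWith R).comp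
      (lipschitzWith_radialRetraction hR).lipschitzOnWith
      fun x _ => mem_closedBall_zero_iff.mpr (norm_radialRetraction_le hR x))
  have hpl : IsPicardLindelof (fun _ x => -truncatedField G R x) (tmin := 0) (tmax := T)
      ⟨0, le_rfl, hT⟩ z₀ (C * (1 + R) * R * T).toNNReal 0 (C * (1 + R) * R).toNNReal
      ((C * (1 + 2 * R)).toNNReal * 2) := by
    refine IsPicardLindelof.of_time_independent (fun x _ => ?_) (hlip _) ?_
    · rw [norm_neg, Real.coe_toNNReal _ hL]
      exact hG.norm_le (norm_radialRetraction_le hR x)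
    · simp [Real.coe_toNNReal _ hL, Real.coe_toNNReal _ (mul_nonneg hL hT), hT]
  obtain ⟨z, hz0, hz⟩ := hpl.exists_eq_forall_mem_Icc_hasDerivWithinAt₀
  have hc : ContinuousOn z (Set.Icc 0 T) := fun t ht => (hz t ht).continuousWithinAt
  have hF := (hG.continuous_truncatedField hR).neg
  refine ⟨z, hc, fun t ht => ?_⟩
  have hsub : Set.uIcc 0 t ⊆ Set.Icc 0 T := Set.uIcc_subset_Icc ⟨le_rfl, hT⟩ ht
  have h := ODE.picard_eq_of_hasDerivAt (f := fun _ x => -truncatedField G R x) (t₀ := 0)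
    (u := Set.univ) (α := z) (t := t) (hF.comp continuous_snd).continuousOn
    (fun t' ht' => (hz t' (hsub ht')).mono hsub) (Set.mapsTo_univ _ _)
  rw [← h, ODE.picard_apply, hz0, intervalIntegral.integral_neg, sub_eq_add_neg]

/-- Local existence, with a lifespan and a bound that depend only on the size of the datum. -/
lemma QuadraticLipschitz.exists_local_solution (hG : QuadraticLipschitz C G) {ρ : ℝ} (hρ : 0 < ρ)
    (hT : 0 ≤ T) (hTρ : C * (1 + 2 * ρ) * (2 * ρ) * T ≤ ρ) (hz₀ : ‖z₀‖ ≤ ρ) :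
    ∃ z, IsIntegralSolution G T z₀ z ∧ ∀ t ∈ Set.Icc 0 T, ‖z t‖ ≤ 2 * ρ := by
  have hR : 0 < 2 * ρ := by linarith
  obtain ⟨z, hz⟩ := hG.exists_truncated_solution hR hT z₀
  have hb : ∀ t ∈ Set.Icc 0 T, ‖z t‖ ≤ 2 * ρ := by
    intro t ht
    have h1 : ‖∫ τ in (0 : ℝ)..t, truncatedField G (2 * ρ) (z τ)‖ ≤
        C * (1 + 2 * ρ) * (2 * ρ) * |t - 0| :=
      intervalIntegral.norm_integral_le_of_norm_le_const fun τ _ =>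
        hG.norm_le (norm_radialRetraction_le hR _)
    have h0 : 0 ≤ C * (1 + 2 * ρ) * (2 * ρ) :=
      mul_nonneg (mul_nonneg hG.1 (by linarith)) hR.le
    rw [sub_zero, abs_of_nonneg ht.1] at h1
    have h2 := mul_le_mul_of_nonneg_left ht.2 h0
    rw [hz.2 t ht]
    have := norm_sub_le z₀ (∫ τ in (0 : ℝ)..t, truncatedField G (2 * ρ) (z τ))
    linarith
  exact ⟨z, hz.of_truncatedField hR hb, hb⟩

/-- Local well-posedness: on a time interval that depends only on `ρ`, solutions with data in the
ball of radius `ρ` exist and depend on the data with Lipschitz constant `2`. -/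
lemma QuadraticLipschitz.locally_wellPosed (hG : QuadraticLipschitz C G) {ρ : ℝ} (hρ : 0 < ρ) :
    ∃ T, 0 < T ∧ (∀ z₀ : E, ‖z₀‖ ≤ ρ → ∃ z, IsIntegralSolution G T z₀ z) ∧
      ∀ (z₀ w₀ : E) (z w : ℝ → E), ‖z₀‖ ≤ ρ → ‖w₀‖ ≤ ρ → IsIntegralSolution G T z₀ z →
        IsIntegralSolution G T w₀ w → ∀ t ∈ Set.Icc 0 T, ‖z t - w t‖ ≤ 2 * ‖z₀ - w₀‖ := by
  have hC := hG.1
  have hlog : (1 / 2 : ℝ) ≤ Real.log 2 := by linarith [Real.log_two_gt_d9]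
  set D : ℝ := C * (1 + 4 * ρ) with hD
  have hD0 : 0 ≤ D := by positivity
  -- `D T ≤ 1/2` keeps solutions in the ball of radius `2ρ` and gives `exp (D T) ≤ 2`.
  set T : ℝ := 1 / (2 * (D + 1)) with hTdef
  have hT : 0 < T := by positivity
  have hDT : D * T ≤ 1 / 2 := by
    rw [hTdef, mul_one_div, div_le_div_iff₀ (by positivity) (by norm_num)]
    linarith
  have hTρ : C * (1 + 2 * ρ) * (2 * ρ) * T ≤ ρ := by
    have h1 : C * (1 + 2 * ρ) ≤ D := mul_le_mul_of_nonneg_left (by linarith) hC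
    calc C * (1 + 2 * ρ) * (2 * ρ) * T ≤ D * (2 * ρ) * T := by gcongr
      _ = D * T * (2 * ρ) := by ring
      _ ≤ 1 / 2 * (2 * ρ) := by gcongr
      _ = ρ := by ring
  have hbound : ∀ (z₀ : E) (z : ℝ → E), ‖z₀‖ ≤ ρ → IsIntegralSolution G T z₀ z →
      ∀ t ∈ Set.Icc 0 T, ‖z t‖ ≤ 2 * ρ := by
    intro z₀ z hz₀ hz t ht
    obtain ⟨y, hy, hyb⟩ := hG.exists_local_solution hρ hT.le hTρ hz₀
    rw [hz.eqOn hG hy ht]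
    exact hyb t ht
  refine ⟨T, hT, fun z₀ hz₀ => ?_, fun z₀ w₀ z w hz₀ hw₀ hz hw t ht => ?_⟩
  · obtain ⟨y, hy, -⟩ := hG.exists_local_solution hρ hT.le hTρ hz₀
    exact ⟨y, hy⟩
  · refine (hz.norm_sub_le hG hw (hbound z₀ z hz₀ hz) (hbound w₀ w hw₀ hw) ht).trans ?_
    rw [mul_comm]
    refine mul_le_mul_of_nonneg_right ?_ (norm_nonneg _)
    rw [← Real.le_log_iff_exp_le two_pos]
    calc C * (1 + 2 * (2 * ρ)) * t = D * t := by rw [hD]; ring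
      _ ≤ D * T := by gcongr; exact ht.2
      _ ≤ Real.log 2 := hDT.trans hlog

end ODE

section Energy

variable {H : Type*} [NormedAddCommGroup H] [InnerProductSpace ℝ H] [CompleteSpace H]
  {G : H → H} {C R T : ℝ} {z₀ : H} {z : ℝ → H}

lemma IsIntegralSolution.energy_identity (hG : Continuous G)
    (hz : IsIntegralSolution G T z₀ z) {s t : ℝ} (hs : 0 ≤ s) (hst : s ≤ t) (ht : t ≤ T) :
    ‖z t‖ ^ 2 = ‖z s‖ ^ 2 - 2 * ∫ τ in s..t, inner ℝ (z τ) (G (z τ)) := by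
  have hsub : Set.Icc s t ⊆ Set.Icc 0 T := Set.Icc_subset_Icc hs ht
  have hcz := hz.1.mono hsub
  have hcont : ContinuousOn (fun τ => -2 * inner ℝ (z τ) (G (z τ))) (Set.Icc s t) :=
    continuousOn_const.mul (hcz.inner (hG.comp_continuousOn hcz))
  have h := intervalIntegral.integral_eq_sub_of_hasDerivAt_of_le hst
    (f := fun τ => ‖z τ‖ ^ 2) (f' := fun τ => -2 * inner ℝ (z τ) (G (z τ))) (hcz.norm.pow 2)
    (fun τ hτ => ?_) ((hcont.mono (Set.uIcc_of_le hst).subset).intervalIntegrable)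
  · rw [intervalIntegral.integral_const_mul] at h
    linarith
  · have hτ' : τ ∈ Set.Ioo 0 T := ⟨hs.trans_lt hτ.1, hτ.2.trans_le ht⟩
    have hd := (hz.hasDerivWithinAt hG (Set.Ioo_subset_Icc_self hτ')).hasDerivAt
      (Icc_mem_nhds hτ'.1 hτ'.2)
    have h2 := hd.norm_sq
    rw [inner_neg_right, mul_neg, ← neg_mul] at h2
    exact h2

lemma IsIntegralSolution.norm_antitone (hG : Continuous G) (hpos : ∀ x, 0 ≤ inner ℝ x (G x))
    (hz : IsIntegralSolution G T z₀ z) {s t : ℝ} (hs : 0 ≤ s) (hst : s ≤ t) (ht : t ≤ T) :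
    ‖z t‖ ≤ ‖z s‖ := by
  have h := hz.energy_identity hG hs hst ht
  have h2 := intervalIntegral.integral_nonneg hst (μ := volume)
    (f := fun τ => inner ℝ (z τ) (G (z τ))) (fun τ _ => hpos _)
  exact (sq_le_sq₀ (norm_nonneg _) (norm_nonneg _)).mp (by linarith)

/-- If `⟪x, G x⟫ ≥ 0`, then the norm does not increase, also for the truncated equation; thus
solutions of the latter never leave the ball and solve the equation itself. -/
lemma QuadraticLipschitz.exists_solution_of_inner_nonneg (hG : QuadraticLipschitz C G)
    (hpos : ∀ x, 0 ≤ inner ℝ x (G x)) (hT : 0 ≤ T) (z₀ : H) :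
    ∃ z, IsIntegralSolution G T z₀ z := by
  have hR : 0 < ‖z₀‖ + 1 := by positivity
  obtain ⟨z, hz⟩ := hG.exists_truncated_solution hR hT z₀
  -- `x` is a positive multiple of its retraction, so the sign condition survives truncation
  have hpos' : ∀ x, 0 ≤ inner ℝ x (truncatedField G (‖z₀‖ + 1) x) := by
    intro x
    have hm : 0 < max (‖z₀‖ + 1) ‖x‖ := lt_max_of_lt_left hR
    have h := hpos (radialRetraction (‖z₀‖ + 1) x)
    rw [radialRetraction, real_inner_smul_left] at h
    exact nonneg_of_mul_nonneg_right h (by positivity)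
  refine ⟨z, hz.of_truncatedField hR fun t ht => ?_⟩
  have h := hz.norm_antitone (hG.continuous_truncatedField hR) hpos' le_rfl ht.1 ht.2
  rw [hz.initial hT] at h
  linarith

/-- Solutions on the intervals `[0,T]` agree on their common domain, so they define a global one. -/
lemma QuadraticLipschitz.exists_global_solution (hG : QuadraticLipschitz C G)
    (hpos : ∀ x, 0 ≤ inner ℝ x (G x)) (z₀ : H) :
    ∃ z, ∀ T, 0 < T → IsIntegralSolution G T z₀ z := by
  choose y hy using fun n : ℕ => hG.exists_solution_of_inner_nonneg hpos n.cast_nonneg z₀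
  have hagree : ∀ T : ℝ, 0 < T → Set.EqOn (fun t => y ⌈t⌉₊ t) (y ⌈T⌉₊) (Set.Icc 0 T) := by
    intro T _ t ht
    exact (hy ⌈t⌉₊).eqOn hG ((hy ⌈T⌉₊).mono (Nat.cast_le.mpr (Nat.ceil_mono ht.2)))
      ⟨ht.1, Nat.le_ceil t⟩
  refine ⟨fun t => y ⌈t⌉₊ t, fun T hT => ?_⟩
  have h := (hy ⌈T⌉₊).mono (Nat.le_ceil T)
  refine ⟨h.1.congr (hagree T hT), fun t ht => ?_⟩
  rw [hagree T hT ht, h.2 t ht]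
  congr 1
  refine intervalIntegral.integral_congr fun τ hτ => ?_
  rw [hagree T hT (Set.uIcc_subset_Icc ⟨le_rfl, hT.le⟩ ht hτ)]

end Energy

/-! ### Solutions in `H^s` as solutions of an ordinary differential equation in `L²` -/

section Bridge

variable {a : Torus → ℝ} {A : L2} {s T : ℝ} {u₀ z₀ : L2} {u z : ℝ → L2}

lemma continuous_stateField (hA : A =ᵐ[torusMeasure] a) (hs : 0 ≤ s)
    (hAs : MemH s A) : Continuous (stateField a s hs) :=
  let ⟨_, hC⟩ := quadraticLipschitz_stateField hA hs hAs
  hC.continuous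

lemma IsSolutionOn.initial (hu : IsSolutionOn a s T u₀ u) (hT : 0 ≤ T) : u 0 = u₀ := by
  simpa using hu.2 0 ⟨le_rfl, hT⟩

lemma IsSolutionOn.memH_initial (hu : IsSolutionOn a s T u₀ u) (hT : 0 ≤ T) : MemH s u₀ :=
  hu.initial hT ▸ hu.1.1 0 ⟨le_rfl, hT⟩

lemma ContinuousInH.continuousOn_lift (hu : ContinuousInH s T u) :
    ContinuousOn (fun t => lift s (u t)) (Set.Icc 0 T) := by
  intro t ht
  rw [ContinuousWithinAt, tendsto_iff_norm_sub_tendsto_zero]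
  refine (hu.2 t ht).congr' ?_
  filter_upwards [self_mem_nhdsWithin] with τ hτ
  rw [← lift_sub (hu.1 τ hτ) (hu.1 t ht), norm_lift (memH_sub (hu.1 τ hτ) (hu.1 t ht))]

lemma IsSolutionOn.isIntegralSolution (hA : A =ᵐ[torusMeasure] a) (hs : 0 ≤ s)
    (hAs : MemH s A) (hT : 0 ≤ T) (hu : IsSolutionOn a s T u₀ u) :
    IsIntegralSolution (stateField a s hs) T (lift s u₀) fun t => lift s (u t) := by
  have hc := hu.1.continuousOn_lift
  refine ⟨hc, fun t ht => bessel_injective hs ?_⟩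
  have hsub : Set.uIcc 0 t ⊆ Set.Icc 0 T := Set.uIcc_subset_Icc ⟨le_rfl, hT⟩ ht
  have hint : IntervalIntegrable (fun τ => stateField a s hs (lift s (u τ))) volume 0 t :=
    ((continuous_stateField hA hs hAs).comp_continuousOn
      (hc.mono hsub)).intervalIntegrable
  rw [map_sub, bessel_lift hs (hu.1.1 t ht), bessel_lift hs (hu.memH_initial hT),
    ← (bessel s hs).intervalIntegral_comp_comm hint, hu.2 t ht]
  congr 1
  refine intervalIntegral.integral_congr fun τ hτ => ?_
  rw [bessel_stateField hA hs hAs, bessel_lift hs (hu.1.1 τ (hsub hτ))]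

lemma IsIntegralSolution.isSolutionOn (hA : A =ᵐ[torusMeasure] a) (hs : 0 ≤ s)
    (hAs : MemH s A) (hz : IsIntegralSolution (stateField a s hs) T z₀ z) :
    IsSolutionOn a s T (bessel s hs z₀) fun t => bessel s hs (z t) := by
  refine ⟨⟨fun t _ => memH_bessel hs _, fun t ht => ?_⟩, fun t ht => ?_⟩
  · have h := tendsto_iff_norm_sub_tendsto_zero.mp (hz.1 t ht)
    refine h.congr fun τ => ?_
    rw [← map_sub, normH_bessel]
  · have hint : IntervalIntegrable (fun τ => stateField a s hs (z τ)) volume 0 t :=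
      hz.intervalIntegrable (continuous_stateField hA hs hAs)
        ⟨le_rfl, ht.1.trans ht.2⟩ ht
    beta_reduce
    rw [hz.2 t ht, map_sub, ← (bessel s hs).intervalIntegral_comp_comm hint]
    simp only [bessel_stateField hA hs hAs]

lemma IsSolutionOn.eqOn (hA : A =ᵐ[torusMeasure] a) (hs : 0 ≤ s) (hAs : MemH s A) (hT : 0 ≤ T)
    {w : ℝ → L2} (hu : IsSolutionOn a s T u₀ u) (hw : IsSolutionOn a s T u₀ w) :
    Set.EqOn u w (Set.Icc 0 T) := by
  obtain ⟨C, hC⟩ := quadraticLipschitz_stateField hA hs hAs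
  intro t ht
  exact lift_injective (hu.1.1 t ht) (hw.1.1 t ht)
    ((hu.isIntegralSolution hA hs hAs hT).eqOn hC (hw.isIntegralSolution hA hs hAs hT) ht)

/-- The Sobolev exponent of a solution can be lowered. -/
lemma IsSolutionOn.of_le {r : ℝ} (hrs : r ≤ s) (hu : IsSolutionOn a s T u₀ u) :
    IsSolutionOn a r T u₀ u := by
  refine ⟨⟨fun t ht => memH_of_le hrs (hu.1.1 t ht), fun t ht => ?_⟩, hu.2⟩
  refine squeeze_zero' (Eventually.of_forall fun _ => normH_nonneg _ _) ?_ (hu.1.2 t ht)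
  filter_upwards [self_mem_nhdsWithin] with τ hτ
  exact normH_mono hrs (memH_sub (hu.1.1 τ hτ) (hu.1.1 t ht))

theorem local_wellPosedness (hA : A =ᵐ[torusMeasure] a) (hs : 0 ≤ s) (hAs : MemH s A)
    {ρ : ℝ} (hρ : 0 < ρ) : ∃ T : ℝ, 0 < T ∧
      (∀ u₀ : L2, MemH s u₀ → normH s u₀ ≤ ρ → ∃ u : ℝ → L2, IsSolutionOn a s T u₀ u) ∧
      (∀ u₀ w₀ : L2, MemH s u₀ → normH s u₀ ≤ ρ → MemH s w₀ → normH s w₀ ≤ ρ →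
        ∀ u w : ℝ → L2, IsSolutionOn a s T u₀ u → IsSolutionOn a s T w₀ w →
          ∀ t ∈ Set.Icc 0 T, normH s (u t - w t) ≤ 2 * normH s (u₀ - w₀)) := by
  obtain ⟨C, hC⟩ := quadraticLipschitz_stateField hA hs hAs
  obtain ⟨T, hT, hex, hlip⟩ := hC.locally_wellPosed hρ
  refine ⟨T, hT, fun u₀ hu₀ hu₀ρ => ?_, fun u₀ w₀ hu₀ hu₀ρ hw₀ hw₀ρ u w hu hw t ht => ?_⟩
  · obtain ⟨z, hz⟩ := hex (lift s u₀) (by rwa [norm_lift hu₀])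
    exact ⟨_, bessel_lift hs hu₀ ▸ hz.isSolutionOn hA hs hAs⟩
  · have h := hlip (lift s u₀) (lift s w₀) _ _ (by rwa [norm_lift hu₀]) (by rwa [norm_lift hw₀])
      (hu.isIntegralSolution hA hs hAs hT.le) (hw.isIntegralSolution hA hs hAs hT.le) t ht
    rwa [← lift_sub (hu.1.1 t ht) (hw.1.1 t ht), ← lift_sub hu₀ hw₀,
      norm_lift (memH_sub (hu.1.1 t ht) (hw.1.1 t ht)), norm_lift (memH_sub hu₀ hw₀)] at h

end Bridge

/-! ### Dissipation of energy -/

/-- Multiplication by a continuous function, on `L²`. -/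
lemma exists_mul_continuous {a : Torus → ℝ} (ha : Continuous a) (u : L2) :
    ∃ g : L2, g =ᵐ[torusMeasure] fun x => a x * u x := by
  obtain ⟨M, hM⟩ := isCompact_univ.exists_bound_of_continuousOn ha.continuousOn
  have hm : MemLp (fun x => a x * u x) 2 torusMeasure :=
    (Lp.memLp u).of_le_mul (c := M) (ha.aestronglyMeasurable.mul (Lp.aestronglyMeasurable u))
      (Eventually.of_forall fun x => by
        rw [norm_mul]
        exact mul_le_mul_of_nonneg_right (hM x (Set.mem_univ x)) (norm_nonneg _))
  exact ⟨hm.toLp _, hm.coeFn_toLp⟩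

/-- The rate at which the damping dissipates energy. -/
def dissipation (a : Torus → ℝ) (u : L2) : ℝ := ∫ x, a x * u x ^ 2 ∂torusMeasure

lemma dissipation_nonneg {a : Torus → ℝ} (ha : ∀ x, 0 ≤ a x) (u : L2) : 0 ≤ dissipation a u :=
  integral_nonneg fun x => mul_nonneg (ha x) (sq_nonneg _)

lemma dissipation_eq_inner {a : Torus → ℝ} {u g : L2}
    (hg : g =ᵐ[torusMeasure] fun x => a x * u x) : dissipation a u = inner ℝ u g := by
  rw [L2.inner_def, dissipation]
  refine integral_congr_ae ?_
  filter_upwards [hg] with x hx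
  rw [hx]
  simp
  ring

lemma hasSum_dissipation {a : Torus → ℝ} (ha : Continuous a) (u : L2) :
    HasSum (fun n => (coeff u n * (starRingEnd ℂ) (coeff (fun x => a x * u x) n)).re)
      (dissipation a u) := by
  obtain ⟨g, hg⟩ := exists_mul_continuous ha u
  rw [dissipation_eq_inner hg, ← coeff_congr hg]
  exact hasSum_inner u g

lemma summable_norm_coeff {u : L2} (hu : MemH 1 u) : Summable fun n => ‖coeff u n‖ := by
  have h := (cauchy_schwarz_tsum (fun n => (wt_pos (-1) n).le)
    (fun n => norm_nonneg ((wt 1 n : ℂ) * coeff u n)) summable_wt_neg_one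
    ((memH_iff 1 u).mp hu)).1
  refine h.congr fun n => ?_
  rw [norm_mul, Complex.norm_real, Real.norm_of_nonneg (wt_pos 1 n).le, ← mul_assoc, wt_neg_mul,
    one_mul]

/-- The sum of `n c_n c_k c_m` over `n + k + m = 0` vanishes: symmetrising in the three indices
replaces `n` by `(n + k + m) / 3`. -/
lemma hasSum_cubic_form {c : ℤ → ℂ} (hc1 : Summable fun n => ‖c n‖)
    (hc2 : Summable fun n => ‖c n‖ ^ 2) (hn : Summable fun n : ℤ => ‖(n : ℂ) * c n‖ ^ 2) :
    HasSum (fun p : ℤ × ℤ => p.1 * c p.1 * (c (-p.1 - p.2) * c p.2)) 0 := by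
  let F : ℤ × ℤ → ℂ := fun p => p.1 * c p.1 * (c (-p.1 - p.2) * c p.2)
  have hF : Summable F := by
    rw [← (Equiv.prodComm ℤ ℤ).summable_iff]
    refine Summable.of_norm ?_
    -- for fixed `k` the sum over `n` is at most `‖c k‖` times a product of two `ℓ²` norms
    have hcs : ∀ k : ℤ, _ := fun k => cauchy_schwarz_tsum
      (F := fun n : ℤ => ‖(n : ℂ) * c n‖) (G := fun n => ‖c (-n - k)‖)
      (fun _ => norm_nonneg _) (fun _ => norm_nonneg _) hn
      ((((Equiv.neg ℤ).trans (Equiv.subRight k)).summable_iff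
        (f := fun n => ‖c n‖ ^ 2)).mpr hc2)
    have htr : ∀ k : ℤ, ∑' n, ‖c (-n - k)‖ ^ 2 = ∑' n, ‖c n‖ ^ 2 := fun k =>
      ((Equiv.neg ℤ).trans (Equiv.subRight k)).tsum_eq (fun n => ‖c n‖ ^ 2)
    have heq : ∀ k n : ℤ, ‖(F ∘ Equiv.prodComm ℤ ℤ) (k, n)‖ =
        ‖c k‖ * (‖(n : ℂ) * c n‖ * ‖c (-n - k)‖) := fun k n => by
      simp only [F, Function.comp_apply, Equiv.prodComm_apply, Prod.swap_prod_mk, norm_mul]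
      ring
    rw [summable_prod_of_nonneg fun _ => norm_nonneg _]
    refine ⟨fun k => ?_, ?_⟩
    · simp only [heq]
      exact (hcs k).1.mul_left _
    · simp only [heq, tsum_mul_left]
      refine Summable.of_nonneg_of_le
        (fun k => mul_nonneg (norm_nonneg _) (tsum_nonneg fun n => by positivity))
        (fun k => mul_le_mul_of_nonneg_left (hcs k).2 (norm_nonneg _)) ?_
      simp only [htr]
      exact hc1.mul_right _
  -- the exchange of the first index with the third, `m = -n - k`
  let e : ℤ × ℤ ≃ ℤ × ℤ :=
    { toFun := fun p => (-p.1 - p.2, p.2)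
      invFun := fun p => (-p.1 - p.2, p.2)
      left_inv := fun p => by simp
      right_inv := fun p => by simp }
  have hS : ∑' p, F p = 0 := by
    have h1 : ∑' p, F (Prod.swap p) = ∑' p, F p := (Equiv.prodComm ℤ ℤ).tsum_eq F
    have h2 : ∑' p, F (e p) = ∑' p, F p := e.tsum_eq F
    have s1 : Summable fun p => F (Prod.swap p) := (Equiv.prodComm ℤ ℤ).summable_iff.mpr hF
    have s2 : Summable fun p => F (e p) := e.summable_iff.mpr hF
    have h3 : ∑' p, (F p + F (Prod.swap p) + F (e p)) = 0 := by
      rw [← tsum_zero (α := ℂ) (β := ℤ × ℤ)]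
      refine tsum_congr fun p => ?_
      have : -(-p.1 - p.2) - p.2 = p.1 := by ring
      simp only [F, e, Equiv.coe_fn_mk, Prod.fst_swap, Prod.snd_swap, this,
        show -p.2 - p.1 = -p.1 - p.2 by ring]
      push_cast
      ring
    rw [(hF.add s1).tsum_add s2, hF.tsum_add s1, h1, h2] at h3
    have h4 : (3 : ℂ) * ∑' p, F p = 0 := by linear_combination h3
    simpa using h4
  exact hS ▸ hF.hasSum

/-- The conservation law `∫ u² u_x = 0` on the Fourier side. -/
lemma hasSum_cubic {u : L2} (hu : MemH 1 u) :
    HasSum (fun n : ℤ => n * coeff u n * (starRingEnd ℂ) (coeff (fun x => u x * u x) n)) 0 := by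
  have hn : Summable fun n : ℤ => ‖(n : ℂ) * coeff u n‖ ^ 2 := by
    refine Summable.of_nonneg_of_le (fun n => by positivity) (fun n => ?_) ((memH_iff 1 u).mp hu)
    rw [norm_mul, norm_mul, Complex.norm_real, Real.norm_of_nonneg (wt_pos 1 n).le,
      ← Complex.ofReal_intCast, Complex.norm_real, Real.norm_eq_abs]
    gcongr
    exact abs_le_wt_one n
  have h := (hasSum_cubic_form (summable_norm_coeff hu) (hasSum_sq u).summable hn).prod_fiberwise
    (fun n => (hasSum_coeff_mul u u (-n)).mul_left (n * coeff u n))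
  simpa only [coeff_neg_index] using h

/-- The energy identity in differential form: the dispersive and nonlinear terms drop out, and only
the damping contributes. -/
lemma inner_stateField {a : Torus → ℝ}
    (ha : ContDiff ℝ (⊤ : ℕ∞) (fun x : ℝ => a (x : Torus))) (z : L2) :
    inner ℝ z (stateField a 1 zero_le_one z) = dissipation a (bessel 1 zero_le_one z) := by
  obtain ⟨A, hA, hAs⟩ := exists_memH_of_contDiff ha
  set u := bessel 1 zero_le_one z with hu
  have hus : MemH 1 u := memH_bessel _ z
  have hcz : ∀ n, coeff z n = wt 1 n * coeff u n := fun n => by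
    rw [← coeff_lift hus, hu, lift_bessel]
  have hf := memH_field hA zero_le_one (hAs 1) hus
  have h0 := hasSum_inner z (stateField a 1 zero_le_one z)
  have h1 := (hasSum_dissipation (continuous_of_contDiff ha) u)
  have h2 : HasSum (fun n : ℤ => (coeff u n * (starRingEnd ℂ)
      (Complex.I * n * coeff (fun x => u x * fluxFactor u x) n)).re) 0 := by
    have h3 := Complex.reCLM.hasSum ((hasSum_cubic hus).mul_left (-Complex.I / 2))
    simp only [mul_zero, map_zero] at h3
    refine h3.congr_fun fun n => ?_
    have e : coeff (fun x => u x * fluxFactor u x) n =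
        coeff u n + (1 / 2 : ℂ) * coeff (fun x => u x * u x) n := by
      have e1 : (coeff fun x => u x * fluxFactor u x) =
          coeff fun x => u x + (1 / 2) * (u x * u x) := by
        refine coeff_congr ?_
        filter_upwards [fluxFactor_ae u] with x hx
        rw [hx]
        ring
      rw [e1, coeff_fun_add (integrable_L2 u) ((integrable_mul u u).const_mul _)]
      congr 1
      unfold coeff
      rw [← fourierCoeff.const_mul]
      push_cast
      rfl
    rw [e]
    have e2 : coeff u n * (starRingEnd ℂ) (Complex.I * n *
        (coeff u n + (1 / 2 : ℂ) * coeff (fun x => u x * u x) n)) =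
        -Complex.I * ((n * ‖coeff u n‖ ^ 2 : ℝ) : ℂ) + -Complex.I / 2 * (n * coeff u n *
          (starRingEnd ℂ) (coeff (fun x => u x * u x) n)) := by
      have e3 := Complex.mul_conj' (coeff u n)
      simp only [map_mul, map_add, Complex.conj_I, map_intCast, map_div₀, map_one, map_ofNat]
      push_cast
      rw [← e3]
      ring
    have e4 : (-Complex.I * ((n * ‖coeff u n‖ ^ 2 : ℝ) : ℂ)).re = 0 := by
      rw [Complex.re_mul_ofReal]
      simp
    rw [e2, Complex.add_re, e4, zero_add, Complex.reCLM_apply]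
  have h3 := h1.add h2
  rw [add_zero] at h3
  refine h0.unique (h3.congr_fun fun n => ?_)
  rw [stateField, ← hu, coeff_lift hf, coeff_field hA, hcz, ← coeff_damping hA]
  have hw : (wt 1 n : ℂ) * wt 1 n = 1 + (n : ℂ) ^ 2 := by
    rw [← Complex.ofReal_mul, wt_mul, one_add_one_eq_two, wt_two]
    push_cast
    rfl
  have hne : (wt 1 n : ℂ) ≠ 0 := by exact_mod_cast (wt_pos 1 n).ne'
  rw [← Complex.add_re, ← mul_add, ← map_add]
  congr 1
  simp only [invHelmholtz, Pi.add_apply, ddx, map_mul, map_div₀, Complex.conj_ofReal, map_add,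
    map_one, map_pow, map_intCast]
  rw [← hw]
  field_simp

/-! ### Weak convergence in `H^s` and convergence of Fourier coefficients -/

section Weak

variable {ι : Type*} {l : Filter ι} {f : ι → L2} {v : L2} {s R : ℝ}

lemma wt_mul_norm_coeff_le {u : L2} (hu : MemH s u) (n : ℤ) :
    wt s n * ‖coeff u n‖ ≤ normH s u := by
  have h := norm_coeff_le (lift s u) n
  rwa [coeff_lift hu, norm_mul, Complex.norm_real, Real.norm_of_nonneg (wt_pos s n).le,
    norm_lift hu] at h

lemma hasSum_normH_sq {u : L2} (hu : MemH s u) :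
    HasSum (fun n => ‖(wt s n : ℂ) * coeff u n‖ ^ 2) (normH s u ^ 2) := by
  rw [← norm_lift hu]
  simp_rw [← coeff_lift hu]
  exact hasSum_sq _

lemma tendsto_wt_of_neg {r : ℝ} (hr : r < 0) : Tendsto (wt r) cofinite (𝓝 0) := by
  have h1 : Tendsto (fun n : ℤ => 1 + (n : ℝ) ^ 2) cofinite atTop := by
    refine tendsto_atTop_add_const_left _ _ ?_
    rw [Int.cofinite_eq, tendsto_sup]
    refine ⟨?_, (tendsto_pow_atTop two_ne_zero).comp tendsto_intCast_atTop_atTop⟩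
    have : Tendsto (fun n : ℤ => (-(n : ℝ)) ^ 2) atBot atTop :=
      (tendsto_pow_atTop two_ne_zero).comp
        (tendsto_neg_atBot_atTop.comp (tendsto_intCast_atBot_iff.mpr tendsto_id))
    simpa using this
  have h2 := (tendsto_rpow_neg_atTop (y := -(r / 2)) (by linarith)).comp h1
  refine h2.congr fun n => ?_
  simp [wt]

/-- Rellich's theorem, for sequences: boundedness in `H^s` and convergence of each Fourier
coefficient give convergence in `H^r` for `r < s`, since the high frequencies are uniformly small
in `H^r`. -/
lemma tendsto_normH_of_tendsto_coeff {r : ℝ} (hrs : r < s)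
    (hf : ∀ᶠ i in l, MemH s (f i) ∧ normH s (f i) ≤ R)
    (hc : ∀ n, Tendsto (fun i => coeff (f i) n) l (𝓝 0)) :
    Tendsto (fun i => normH r (f i)) l (𝓝 0) := by
  have hsq : Tendsto (fun i => normH r (f i) ^ 2) l (𝓝 0) := by
    rw [Metric.tendsto_nhds]
    intro ε hε
    obtain ⟨η, hη, hηR⟩ : ∃ η : ℝ, 0 < η ∧ η ^ 2 * R ^ 2 < ε / 2 := by
      have : Tendsto (fun η : ℝ => η ^ 2 * R ^ 2) (𝓝[>] 0) (𝓝 0) := by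
        refine tendsto_nhdsWithin_of_tendsto_nhds ?_
        have h : Continuous fun η : ℝ => η ^ 2 * R ^ 2 := by fun_prop
        simpa using h.tendsto 0
      obtain ⟨η, h1, h2⟩ := ((this.eventually (gt_mem_nhds (half_pos hε))).and
        self_mem_nhdsWithin).exists
      exact ⟨η, h2, h1⟩
    have hfin : {n : ℤ | ¬ wt (r - s) n < η}.Finite :=
      (tendsto_wt_of_neg (sub_neg.mpr hrs)).eventually (gt_mem_nhds hη)
    -- outside the finite set `S` the `H^r` weight is at most `η` times the `H^s` weight
    set S := hfin.toFinset with hS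
    have hlow : Tendsto (fun i => ∑ n ∈ S, ‖(wt r n : ℂ) * coeff (f i) n‖ ^ 2) l (𝓝 0) := by
      rw [← Finset.sum_const_zero (s := S)]
      refine tendsto_finsetSum S fun n _ => ?_
      simpa using (((hc n).const_mul (wt r n : ℂ)).norm).pow 2
    filter_upwards [hf, hlow.eventually (gt_mem_nhds (half_pos hε))] with i ⟨hi, hiR⟩ hi2
    rw [Real.dist_0_eq_abs, abs_of_nonneg (sq_nonneg _)]
    have hr := hasSum_normH_sq (memH_of_le hrs.le hi)
    have hs := hasSum_normH_sq hi
    have hle : normH r (f i) ^ 2 ≤ η ^ 2 * normH s (f i) ^ 2 +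
        ∑ n ∈ S, ‖(wt r n : ℂ) * coeff (f i) n‖ ^ 2 := by
      have hind : HasSum (fun n => if n ∈ S then ‖(wt r n : ℂ) * coeff (f i) n‖ ^ 2 else 0)
          (∑ n ∈ S, ‖(wt r n : ℂ) * coeff (f i) n‖ ^ 2) := by
        have h := hasSum_sum_of_ne_finset_zero (L := .unconditional ℤ)
          (f := fun n => if n ∈ S then ‖(wt r n : ℂ) * coeff (f i) n‖ ^ 2 else 0) (s := S)
          fun n hn => if_neg hn
        rwa [Finset.sum_congr rfl fun n hn => if_pos hn] at h
      refine hasSum_le (fun n => ?_) hr ((hs.mul_left (η ^ 2)).add hind)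
      by_cases hn : n ∈ S
      · rw [if_pos hn]
        have : 0 ≤ η ^ 2 * ‖(wt s n : ℂ) * coeff (f i) n‖ ^ 2 := by positivity
        linarith
      · rw [if_neg hn, add_zero, ← mul_pow]
        refine pow_le_pow_left₀ (norm_nonneg _) ?_ 2
        have hn' : wt (r - s) n < η := by
          by_contra h
          exact hn (by rw [hS, Set.Finite.mem_toFinset]; exact h)
        rw [norm_mul, norm_mul, Complex.norm_real, Complex.norm_real,
          Real.norm_of_nonneg (wt_pos r n).le, Real.norm_of_nonneg (wt_pos s n).le, ← mul_assoc]
        refine mul_le_mul_of_nonneg_right ?_ (norm_nonneg _)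
        have h := wt_mul (r - s) s n
        rw [sub_add_cancel] at h
        rw [← h]
        exact mul_le_mul_of_nonneg_right hn'.le (wt_pos s n).le
    have hR : η ^ 2 * normH s (f i) ^ 2 ≤ η ^ 2 * R ^ 2 := by
      have := normH_nonneg s (f i)
      gcongr
    linarith
  have h := (Real.continuous_sqrt.tendsto 0).comp hsq
  rw [Real.sqrt_zero] at h
  exact h.congr fun i => Real.sqrt_sq (normH_nonneg r (f i))

lemma tendsto_inner_of_tendsto_coeff {g : ι → L2} (hg : ∀ᶠ i in l, ‖g i‖ ≤ R)
    (hc : ∀ n, Tendsto (fun i => coeff (g i) n) l (𝓝 0)) (ψ : L2) :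
    Tendsto (fun i => inner ℝ (g i) ψ) l (𝓝 0) := by
  rw [Metric.tendsto_nhds]
  intro ε hε
  have hψ := (hasSum_sq ψ).summable
  -- a finite set of frequencies that carries all of `ψ` but a small remainder
  obtain ⟨S, hS⟩ : ∃ S : Finset ℤ,
      R * √(∑' n, (if n ∈ S then 0 else ‖coeff ψ n‖) ^ 2) < ε / 2 := by
    have h1 := tendsto_tsum_compl_atTop_zero fun n => ‖coeff ψ n‖ ^ 2
    have h2 : Tendsto (fun S : Finset ℤ => R * √(∑' n : {x // x ∉ S}, ‖coeff ψ n‖ ^ 2)) atTop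
        (𝓝 0) := by
      have h := ((Real.continuous_sqrt.tendsto 0).comp h1).const_mul R
      rwa [Real.sqrt_zero, mul_zero] at h
    obtain ⟨S, hS⟩ := (h2.eventually (gt_mem_nhds (half_pos hε))).exists
    refine ⟨S, ?_⟩
    have h3 : ∑' n : {x // x ∉ S}, ‖coeff ψ n‖ ^ 2 =
        ∑' n, (if n ∈ S then 0 else ‖coeff ψ n‖) ^ 2 := by
      refine (tsum_subtype {x | x ∉ S} fun n => ‖coeff ψ n‖ ^ 2).trans (tsum_congr fun n => ?_)
      by_cases hn : n ∈ S <;> simp [hn]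
    rwa [h3] at hS
  have hlow : Tendsto (fun i => ∑ n ∈ S, ‖coeff (g i) n‖ * ‖coeff ψ n‖) l (𝓝 0) := by
    rw [← Finset.sum_const_zero (s := S)]
    refine tendsto_finsetSum S fun n _ => ?_
    simpa using ((hc n).norm).mul_const ‖coeff ψ n‖
  filter_upwards [hg, hlow.eventually (gt_mem_nhds (half_pos hε))] with i hi hi2
  rw [Real.dist_0_eq_abs]
  have hGs : Summable fun n => (if n ∈ S then 0 else ‖coeff ψ n‖) ^ 2 := by
    refine Summable.of_nonneg_of_le (fun n => sq_nonneg _) (fun n => ?_) hψ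
    split_ifs
    · rw [zero_pow two_ne_zero]
      positivity
    · exact le_rfl
  obtain ⟨hh1, hh2⟩ := cauchy_schwarz_tsum (F := fun n => ‖coeff (g i) n‖)
    (G := fun n => if n ∈ S then 0 else ‖coeff ψ n‖) (fun _ => norm_nonneg _)
    (fun n => by split_ifs <;> positivity) (hasSum_sq (g i)).summable hGs
  rw [(hasSum_sq (g i)).tsum_eq, Real.sqrt_sq (norm_nonneg _)] at hh2
  have hind : HasSum (fun n => if n ∈ S then ‖coeff (g i) n‖ * ‖coeff ψ n‖ else 0)
      (∑ n ∈ S, ‖coeff (g i) n‖ * ‖coeff ψ n‖) := by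
    have h := hasSum_sum_of_ne_finset_zero (L := .unconditional ℤ)
      (f := fun n => if n ∈ S then ‖coeff (g i) n‖ * ‖coeff ψ n‖ else 0) (s := S)
      fun n hn => if_neg hn
    rwa [Finset.sum_congr rfl fun n hn => if_pos hn] at h
  have hle : |inner ℝ (g i) ψ| ≤ (∑' n, ‖coeff (g i) n‖ * if n ∈ S then 0 else ‖coeff ψ n‖) +
      ∑ n ∈ S, ‖coeff (g i) n‖ * ‖coeff ψ n‖ := by
    have hsum := hh1.hasSum.add hind
    refine (hasSum_inner (g i) ψ).norm_le_of_bounded hsum fun n => ?_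
    refine (Complex.abs_re_le_norm _).trans ?_
    rw [norm_mul, RCLike.norm_conj]
    by_cases hn : n ∈ S <;> simp [hn]
  have h3 : ‖g i‖ * √(∑' n, (if n ∈ S then 0 else ‖coeff ψ n‖) ^ 2) ≤
      R * √(∑' n, (if n ∈ S then 0 else ‖coeff ψ n‖) ^ 2) := by gcongr
  linarith

lemma tendsto_coeff_sub (hc : ∀ n, Tendsto (fun i => coeff (f i) n) l (𝓝 (coeff v n))) (n : ℤ) :
    Tendsto (fun i => coeff (f i - v : L2) n) l (𝓝 0) := by
  simp only [coeff_sub]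
  simpa using (hc n).sub_const (coeff v n)

lemma normH_sub_le {u w : L2} (hu : MemH s u) (hw : MemH s w) :
    normH s (u - w) ≤ normH s u + normH s w := by
  rw [← norm_lift (memH_sub hu hw), lift_sub hu hw, ← norm_lift hu, ← norm_lift hw]
  exact norm_sub_le _ _

lemma weakTendstoH_of_tendsto_coeff (hf : ∀ᶠ i in l, MemH s (f i) ∧ normH s (f i) ≤ R)
    (hv : MemH s v) (hc : ∀ n, Tendsto (fun i => coeff (f i) n) l (𝓝 (coeff v n))) :
    WeakTendstoH s f l v := by
  refine ⟨hf.mono fun i hi => hi.1, hv, fun φ hφ => ?_⟩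
  have hb : ∀ᶠ i in l, ‖lift s (f i - v)‖ ≤ R + normH s v := by
    filter_upwards [hf] with i hi
    rw [norm_lift (memH_sub hi.1 hv)]
    exact (normH_sub_le hi.1 hv).trans (by linarith [hi.2])
  have hc' : ∀ n, Tendsto (fun i => coeff (lift s (f i - v)) n) l (𝓝 0) := by
    intro n
    have h := (tendsto_coeff_sub hc n).const_mul (wt s n : ℂ)
    rw [mul_zero] at h
    refine h.congr' ?_
    filter_upwards [hf] with i hi
    rw [coeff_lift (memH_sub hi.1 hv)]
  have h := (tendsto_inner_of_tendsto_coeff hb hc' (lift s φ)).add_const (innerH s v φ)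
  rw [zero_add] at h
  refine h.congr' ?_
  filter_upwards [hf] with i hi
  rw [lift_sub hi.1 hv, inner_sub_left, inner_lift hi.1 hφ, inner_lift hv hφ, sub_add_cancel]

/-- The real trigonometric polynomial `α e^{inx} + conj α e^{-inx}`; testing against it isolates the
`n`-th Fourier coefficient. -/
def trigTest (n : ℤ) (α : ℂ) : L2 :=
  ofCoeff (Pi.single n α + Pi.single (-n) ((starRingEnd ℂ) α))

lemma coeff_trigTest (n : ℤ) (α : ℂ) (k : ℤ) :
    coeff (trigTest n α) k =
      (Pi.single n α + Pi.single (-n) ((starRingEnd ℂ) α) : ℤ → ℂ) k := by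
  refine coeff_ofCoeff ⟨?_, fun m => ?_⟩ k
  · refine summable_of_ne_finset_zero (s := {n, -n}) fun m hm => ?_
    simp only [Finset.mem_insert, Finset.mem_singleton, not_or] at hm
    simp [Pi.single_eq_of_ne hm.1, Pi.single_eq_of_ne hm.2]
  · simp only [Pi.add_apply, Pi.single_apply, map_add]
    rw [add_comm]
    congr 1
    · by_cases h : m = n
      · simp [h]
      · simp [h]
    · by_cases h : m = -n
      · simp [h]
      · rw [if_neg h, if_neg (by omega), map_zero]

lemma memH_trigTest (s : ℝ) (n : ℤ) (α : ℂ) : MemH s (trigTest n α) := by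
  rw [memH_iff]
  refine summable_of_ne_finset_zero (s := {n, -n}) fun m hm => ?_
  simp only [Finset.mem_insert, Finset.mem_singleton, not_or] at hm
  simp [coeff_trigTest, Pi.single_eq_of_ne hm.1, Pi.single_eq_of_ne hm.2]

lemma innerH_trigTest (s : ℝ) (u : L2) (n : ℤ) (α : ℂ) :
    innerH s u (trigTest n α) =
      2 * wt s n ^ 2 * (coeff u n * (starRingEnd ℂ) α).re := by
  have h1 : HasSum (fun k : ℤ => (coeff u k * (starRingEnd ℂ) ((Pi.single n α : ℤ → ℂ) k)).re *
      (1 + (k : ℝ) ^ 2) ^ s) ((coeff u n * (starRingEnd ℂ) α).re * wt s n ^ 2) := by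
    have h := hasSum_single (f := fun k : ℤ =>
      (coeff u k * (starRingEnd ℂ) ((Pi.single n α : ℤ → ℂ) k)).re * (1 + (k : ℝ) ^ 2) ^ s) n
      fun k hk => by simp [Pi.single_eq_of_ne hk]
    simpa [wt_sq] using h
  have h2 : HasSum (fun k : ℤ => (coeff u k * (starRingEnd ℂ)
      ((Pi.single (-n) ((starRingEnd ℂ) α) : ℤ → ℂ) k)).re * (1 + (k : ℝ) ^ 2) ^ s)
      ((coeff u n * (starRingEnd ℂ) α).re * wt s n ^ 2) := by
    have h := hasSum_single (f := fun k : ℤ => (coeff u k * (starRingEnd ℂ)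
      ((Pi.single (-n) ((starRingEnd ℂ) α) : ℤ → ℂ) k)).re * (1 + (k : ℝ) ^ 2) ^ s) (-n)
      fun k hk => by simp [Pi.single_eq_of_ne hk]
    rw [Pi.single_eq_same, coeff_neg_index, ← map_mul, Complex.conj_re, ← wt_sq,
      wt_neg_index] at h
    exact h
  have h := h1.add h2
  unfold innerH
  rw [show 2 * wt s n ^ 2 * (coeff u n * (starRingEnd ℂ) α).re =
    (coeff u n * (starRingEnd ℂ) α).re * wt s n ^ 2 +
      (coeff u n * (starRingEnd ℂ) α).re * wt s n ^ 2 by ring, ← h.tsum_eq]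
  refine tsum_congr fun k => ?_
  rw [coeff_trigTest, Pi.add_apply, map_add, mul_add, Complex.add_re, add_mul]

lemma WeakTendstoH.tendsto_coeff (h : WeakTendstoH s f l v) (n : ℤ) :
    Tendsto (fun i => coeff (f i) n) l (𝓝 (coeff v n)) := by
  have key : ∀ α : ℂ, Tendsto (fun i => (coeff (f i) n * (starRingEnd ℂ) α).re) l
      (𝓝 (coeff v n * (starRingEnd ℂ) α).re) := by
    intro α
    have h1 := (h.2.2 _ (memH_trigTest s n α)).const_mul (2 * wt s n ^ 2)⁻¹
    have hne : 2 * wt s n ^ 2 ≠ 0 := mul_ne_zero two_ne_zero (pow_ne_zero 2 (wt_pos s n).ne')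
    simp only [innerH_trigTest, inv_mul_cancel_left₀ hne] at h1
    exact h1
  have hre := key 1
  have him := key Complex.I
  simp only [map_one, mul_one, Complex.conj_I, mul_neg, Complex.neg_re, Complex.mul_I_re,
    neg_neg] at hre him
  have h3 := (Complex.continuous_ofReal.tendsto _).comp hre |>.add
    (((Complex.continuous_ofReal.tendsto _).comp him).mul_const Complex.I)
  simpa only [Function.comp_apply, Complex.re_add_im] using h3

/-- The norm of `H^s` is weakly lower semicontinuous. -/
lemma WeakTendstoH.normH_le [l.NeBot] (h : WeakTendstoH s f l v)
    (hR : ∀ᶠ i in l, normH s (f i) ≤ R) : normH s v ≤ R := by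
  have h1 := h.2.2 v h.2.1
  have h2 : ∀ᶠ i in l, innerH s (f i) v ≤ R * normH s v := by
    filter_upwards [h.1, hR] with i hi hiR
    rw [← inner_lift hi h.2.1]
    refine (real_inner_le_norm _ _).trans ?_
    rw [norm_lift hi, norm_lift h.2.1]
    exact mul_le_mul_of_nonneg_right hiR (normH_nonneg _ _)
  have h3 := le_of_tendsto h1 h2
  rw [← inner_lift h.2.1 h.2.1, real_inner_self_eq_norm_sq, norm_lift h.2.1, sq] at h3
  rcases (normH_nonneg s v).eq_or_lt with h0 | h0
  · obtain ⟨i, hi⟩ := hR.exists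
    rw [← h0]
    exact (normH_nonneg _ _).trans hi
  · exact le_of_mul_le_mul_right h3 h0

/-- Weak compactness of the balls of `H^s`, `s ≥ 0`. -/
lemma exists_weakTendstoH (hs : 0 ≤ s) (g : Ultrafilter ι)
    (hf : ∀ᶠ i in (g : Filter ι), MemH s (f i) ∧ normH s (f i) ≤ R) :
    ∃ v, WeakTendstoH s f g v := by
  have hlim : ∀ n, ∃ c : ℂ, Tendsto (fun i => coeff (f i) n) g (𝓝 c) := by
    intro n
    have hmem : (g.map fun i => coeff (f i) n : Filter ℂ) ≤
        𝓟 (Metric.closedBall 0 (R / wt s n)) := by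
      rw [le_principal_iff]
      refine Ultrafilter.mem_map.mpr ?_
      filter_upwards [hf] with i hi
      rw [Set.mem_preimage, mem_closedBall_zero_iff, le_div_iff₀ (wt_pos s n), mul_comm]
      exact (wt_mul_norm_coeff_le hi.1 n).trans hi.2
    obtain ⟨c, -, hc⟩ := (isCompact_closedBall (0 : ℂ) (R / wt s n)).ultrafilter_le_nhds
      (g.map fun i => coeff (f i) n) hmem
    exact ⟨c, hc⟩
  choose c hc using hlim
  have hsymm : ∀ n, c (-n) = (starRingEnd ℂ) (c n) := by
    intro n
    refine tendsto_nhds_unique (hc (-n)) ?_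
    simp only [coeff_neg_index]
    exact (Complex.continuous_conj.tendsto _).comp (hc n)
  have hsum : Summable fun n => ‖(wt s n : ℂ) * c n‖ ^ 2 := by
    refine summable_of_sum_le (c := R ^ 2) (fun n => by positivity) fun S => ?_
    refine le_of_tendsto (tendsto_finsetSum S fun n _ =>
      (((hc n).const_mul (wt s n : ℂ)).norm).pow 2) ?_
    filter_upwards [hf] with i hi
    have h := hasSum_normH_sq hi.1
    refine (h.summable.sum_le_tsum S fun n _ => by positivity).trans ?_
    rw [h.tsum_eq]
    have := normH_nonneg s (f i)
    exact pow_le_pow_left₀ this hi.2 2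
  have hseq : IsCoeffSeq c := by
    refine ⟨Summable.of_nonneg_of_le (fun n => by positivity) (fun n => ?_) hsum, hsymm⟩
    rw [norm_mul, Complex.norm_real, Real.norm_of_nonneg (wt_pos s n).le]
    have h1 : 1 ≤ wt s n := (wt_zero n).symm.le.trans (wt_mono hs n)
    exact pow_le_pow_left₀ (norm_nonneg _) (le_mul_of_one_le_left (norm_nonneg _) h1) 2
  refine ⟨ofCoeff c, weakTendstoH_of_tendsto_coeff hf ?_ fun n => ?_⟩
  · rw [memH_iff]
    simpa only [coeff_ofCoeff hseq] using hsum
  · rw [coeff_ofCoeff hseq]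
    exact hc n

end Weak

/-! ### Global solutions and their energy -/

section Global

variable {a : Torus → ℝ} {u₀ v₀ : L2} {u v : ℝ → L2}

lemma inner_stateField_nonneg (ha : ContDiff ℝ (⊤ : ℕ∞) (fun x : ℝ => a (x : Torus)))
    (ha0 : ∀ x, 0 ≤ a x) (z : L2) : 0 ≤ inner ℝ z (stateField a 1 zero_le_one z) := by
  rw [inner_stateField ha]
  exact dissipation_nonneg ha0 _

theorem exists_globalSolution (ha : ContDiff ℝ (⊤ : ℕ∞) (fun x : ℝ => a (x : Torus)))
    (ha0 : ∀ x, 0 ≤ a x) (hu₀ : MemH 1 u₀) : ∃ u, IsGlobalSolution a 1 u₀ u := by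
  obtain ⟨A, hA, hAs⟩ := exists_memH_of_contDiff ha
  obtain ⟨C, hC⟩ := quadraticLipschitz_stateField hA zero_le_one (hAs 1)
  obtain ⟨z, hz⟩ := hC.exists_global_solution (inner_stateField_nonneg ha ha0) (lift 1 u₀)
  exact ⟨_, fun T hT =>
    bessel_lift zero_le_one hu₀ ▸ (hz T hT).isSolutionOn hA zero_le_one (hAs 1)⟩

lemma IsGlobalSolution.memH {s : ℝ} (hu : IsGlobalSolution a s u₀ u) {t : ℝ} (ht : 0 ≤ t) :
    MemH s (u t) :=
  (hu (t + 1) (by linarith)).1.1 t ⟨ht, by linarith⟩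

lemma IsGlobalSolution.initial {s : ℝ} (hu : IsGlobalSolution a s u₀ u) : u 0 = u₀ :=
  (hu 1 one_pos).initial zero_le_one

lemma IsGlobalSolution.continuousOn_dissipation
    (ha : ContDiff ℝ (⊤ : ℕ∞) (fun x : ℝ => a (x : Torus))) (hu : IsGlobalSolution a 1 u₀ u)
    {T : ℝ} (hT : 0 < T) : ContinuousOn (fun τ => dissipation a (u τ)) (Set.Icc 0 T) := by
  obtain ⟨A, hA, hAs⟩ := exists_memH_of_contDiff ha
  have hc := (hu T hT).1.continuousOn_lift
  refine (hc.inner ((continuous_stateField hA zero_le_one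
    (hAs 1)).comp_continuousOn hc)).congr fun τ hτ => ?_
  simp only [Function.comp_apply]
  rw [inner_stateField ha, bessel_lift _ ((hu T hT).1.1 τ hτ)]

lemma IsGlobalSolution.energy_identity
    (ha : ContDiff ℝ (⊤ : ℕ∞) (fun x : ℝ => a (x : Torus))) (hu : IsGlobalSolution a 1 u₀ u)
    {s t : ℝ} (hs : 0 ≤ s) (hst : s ≤ t) :
    normH 1 (u t) ^ 2 = normH 1 (u s) ^ 2 - 2 * ∫ τ in s..t, dissipation a (u τ) := by
  obtain ⟨A, hA, hAs⟩ := exists_memH_of_contDiff ha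
  have hT : 0 < t + 1 := by linarith
  have h := ((hu _ hT).isIntegralSolution hA zero_le_one (hAs 1) hT.le).energy_identity
    (continuous_stateField hA zero_le_one (hAs 1)) hs hst (by linarith)
  rw [norm_lift (hu.memH hs), norm_lift (hu.memH (hs.trans hst))] at h
  rw [h]
  congr 2
  refine intervalIntegral.integral_congr fun τ hτ => ?_
  rw [Set.uIcc_of_le hst] at hτ
  rw [inner_stateField ha, bessel_lift _ (hu.memH (hs.trans hτ.1))]

theorem IsGlobalSolution.antitoneOn_energy
    (ha : ContDiff ℝ (⊤ : ℕ∞) (fun x : ℝ => a (x : Torus))) (ha0 : ∀ x, 0 ≤ a x)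
    (hu : IsGlobalSolution a 1 u₀ u) :
    AntitoneOn (fun t => normH 1 (u t) ^ 2) (Set.Ici 0) := by
  intro s hs t _ hst
  beta_reduce
  rw [hu.energy_identity ha hs hst]
  have := intervalIntegral.integral_nonneg hst (μ := volume)
    (f := fun τ => dissipation a (u τ)) (fun τ _ => dissipation_nonneg ha0 _)
  linarith

lemma IsGlobalSolution.normH_le (ha : ContDiff ℝ (⊤ : ℕ∞) (fun x : ℝ => a (x : Torus)))
    (ha0 : ∀ x, 0 ≤ a x) (hu : IsGlobalSolution a 1 u₀ u) {t : ℝ} (ht : 0 ≤ t) :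
    normH 1 (u t) ≤ normH 1 u₀ := by
  have h := hu.antitoneOn_energy ha ha0 (Set.mem_Ici.mpr le_rfl) (Set.mem_Ici.mpr ht) ht
  beta_reduce at h
  rw [hu.initial] at h
  exact (sq_le_sq₀ (normH_nonneg _ _) (normH_nonneg _ _)).mp h

/-- The energy converges as `t → ∞`, hence the dissipation over a window of fixed length moving to
infinity tends to zero. -/
lemma IsGlobalSolution.tendsto_integral_dissipation
    (ha : ContDiff ℝ (⊤ : ℕ∞) (fun x : ℝ => a (x : Torus))) (ha0 : ∀ x, 0 ≤ a x)
    (hu : IsGlobalSolution a 1 u₀ u) {ι : Type*} {l : Filter ι} {t : ι → ℝ}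
    (ht : Tendsto t l atTop) {T : ℝ} (hT : 0 ≤ T) :
    Tendsto (fun i => ∫ τ in (0 : ℝ)..T, dissipation a (u (t i + τ))) l (𝓝 0) := by
  have hanti : Antitone fun t => normH 1 (u (max t 0)) ^ 2 := fun s t hst =>
    hu.antitoneOn_energy ha ha0 (Set.mem_Ici.mpr (le_max_right _ _))
      (Set.mem_Ici.mpr (le_max_right _ _)) (max_le_max_right 0 hst)
  have hlim := tendsto_atTop_ciInf hanti ⟨0, by rintro _ ⟨t, rfl⟩; positivity⟩
  have h1 := hlim.comp ht
  have h2 := hlim.comp (tendsto_atTop_add_const_right l T ht)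
  have h3 := (h1.sub h2).const_mul (1 / 2)
  rw [sub_self, mul_zero] at h3
  refine h3.congr' ?_
  filter_upwards [ht.eventually_ge_atTop 0] with i hi
  simp only [Function.comp_apply]
  rw [max_eq_left hi, max_eq_left (by linarith : (0 : ℝ) ≤ t i + T),
    hu.energy_identity ha hi (by linarith : t i ≤ t i + T),
    intervalIntegral.integral_comp_add_left (fun τ => dissipation a (u τ)), add_zero]
  ring

lemma integrable_dissipation (ha : Continuous a) (w : L2) :
    Integrable (fun x => a x * w x ^ 2) torusMeasure := by
  obtain ⟨g, hg⟩ := exists_mul_continuous ha w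
  refine (integrable_mul g w).congr ?_
  filter_upwards [hg] with x hx
  rw [hx]
  ring

lemma dissipation_le_add (ha : Continuous a) (ha0 : ∀ x, 0 ≤ a x) (w y : L2) :
    dissipation a w ≤ 2 * dissipation a y + 2 * dissipation a (y - w) := by
  unfold dissipation
  rw [← integral_const_mul, ← integral_const_mul, ← integral_add
    ((integrable_dissipation ha y).const_mul 2) ((integrable_dissipation ha (y - w)).const_mul 2)]
  refine integral_mono_ae (integrable_dissipation ha w)
    (((integrable_dissipation ha y).const_mul 2).add
      ((integrable_dissipation ha (y - w)).const_mul 2)) ?_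
  filter_upwards [Lp.coeFn_sub y w] with x hx
  rw [hx, Pi.sub_apply]
  nlinarith [mul_nonneg (ha0 x) (sq_nonneg (2 * y x - w x))]

lemma exists_dissipation_le (ha : Continuous a) :
    ∃ K, 0 ≤ K ∧ ∀ w : L2, dissipation a w ≤ K * ‖w‖ ^ 2 := by
  obtain ⟨K, hK⟩ := isCompact_univ.exists_bound_of_continuousOn ha.continuousOn
  refine ⟨K, (norm_nonneg _).trans (hK 0 (Set.mem_univ 0)), fun w => ?_⟩
  have e : ‖w‖ ^ 2 = ∫ x, w x ^ 2 ∂torusMeasure := by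
    rw [← real_inner_self_eq_norm_sq, L2.inner_def]
    simp [sq]
  have hint : Integrable (fun x => w x ^ 2) torusMeasure := (Lp.memLp w).integrable_sq
  rw [e, ← integral_const_mul]
  refine integral_mono (integrable_dissipation ha w) (hint.const_mul K) fun x => ?_
  exact mul_le_mul_of_nonneg_right ((le_abs_self _).trans (hK x (Set.mem_univ x))) (sq_nonneg _)

/-! ### Weak limit points of trajectories -/

/-- Uniformly on compact time intervals, the damped flow is continuous in `L²` along data bounded in
`H¹`. Thus the trajectory issued from a weak limit point inherits zero dissipation from the tails
of `u`. -/
lemma dissipation_eq_zero_of_weakTendstoH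
    (ha : ContDiff ℝ (⊤ : ℕ∞) (fun x : ℝ => a (x : Torus))) (ha0 : ∀ x, 0 ≤ a x)
    (hu : IsGlobalSolution a 1 u₀ u) (hv : IsGlobalSolution a 1 v₀ v) {ι : Type*} {l : Filter ι}
    [l.NeBot] {t : ι → ℝ} (ht : Tendsto t l atTop)
    (hw : WeakTendstoH 1 (fun i => u (t i)) l v₀) {τ : ℝ} (hτ : 0 ≤ τ) :
    dissipation a (v τ) = 0 := by
  obtain ⟨A, hA, hAs⟩ := exists_memH_of_contDiff ha
  have hac := continuous_of_contDiff ha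
  obtain ⟨C, hC⟩ := quadraticLipschitz_stateField hA le_rfl (hAs 0)
  obtain ⟨K, hK0, hK⟩ := exists_dissipation_le hac
  set T := τ + 1 with hTdef
  have hT : 0 < T := by linarith
  have hpos : ∀ᶠ i in l, 0 ≤ t i := ht.eventually_ge_atTop 0
  set R := max (normH 1 u₀) (normH 1 v₀) with hR
  have hR0 : 0 ≤ R := (normH_nonneg _ _).trans (le_max_left _ _)
  have hnorm : ∀ {w : L2}, MemH 1 w → ‖w‖ ≤ normH 1 w := fun {w} hw =>
    normH_zero_index w ▸ normH_mono zero_le_one hw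
  have hstrong : Tendsto (fun i => ‖u (t i) - v₀‖) l (𝓝 0) := by
    simp_rw [← normH_zero_index]
    refine tendsto_normH_of_tendsto_coeff (s := 1) (R := normH 1 u₀ + normH 1 v₀) zero_lt_one ?_
      (tendsto_coeff_sub fun n => hw.tendsto_coeff n)
    filter_upwards [hpos] with i hi
    exact ⟨memH_sub (hu.memH hi) hw.2.1, (normH_sub_le (hu.memH hi) hw.2.1).trans
      (by linarith [hu.normH_le ha ha0 hi])⟩
  set M := Real.exp (C * (1 + 2 * R) * T) with hM
  have hclose : ∀ᶠ i in l, ∀ σ ∈ Set.Icc 0 T, ‖u (t i + σ) - v σ‖ ≤ ‖u (t i) - v₀‖ * M := by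
    filter_upwards [hpos] with i hi σ hσ
    have hCd := hC.continuous
    have h1 := (((hu (t i + T) (by linarith)).of_le zero_le_one).isIntegralSolution hA le_rfl
      (hAs 0) (by linarith)).shift hCd hi hT.le
    have h2 := ((hv T hT).of_le zero_le_one).isIntegralSolution hA le_rfl (hAs 0) hT.le
    simp only [lift_zero_index] at h1 h2
    refine (h1.norm_sub_le hC h2 (R := R) (fun σ hσ => ?_) (fun σ hσ => ?_) hσ).trans ?_
    · exact (hnorm (hu.memH (add_nonneg hi hσ.1))).trans
        ((hu.normH_le ha ha0 (add_nonneg hi hσ.1)).trans (le_max_left _ _))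
    · exact (hnorm (hv.memH hσ.1)).trans ((hv.normH_le ha ha0 hσ.1).trans (le_max_right _ _))
    · have := hC.1
      rw [hM]
      gcongr
      exact hσ.2
  have hcont := hv.continuousOn_dissipation ha hT
  have hle : ∀ᶠ i in l, ∫ σ in (0 : ℝ)..T, dissipation a (v σ) ≤
      2 * (∫ σ in (0 : ℝ)..T, dissipation a (u (t i + σ))) +
        T * (2 * (K * (‖u (t i) - v₀‖ * M) ^ 2)) := by
    filter_upwards [hpos, hclose] with i hi hcl
    have hcu : ContinuousOn (fun σ => dissipation a (u (t i + σ))) (Set.uIcc 0 T) := by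
      rw [Set.uIcc_of_le hT.le]
      refine (hu.continuousOn_dissipation ha (by linarith : 0 < t i + T)).comp (by fun_prop)
        fun σ hσ => ⟨add_nonneg hi hσ.1, by linarith [hσ.2]⟩
    have hI1 := (hcu.intervalIntegrable (μ := volume)).const_mul 2
    have hI2 : IntervalIntegrable (fun _ : ℝ => 2 * (K * (‖u (t i) - v₀‖ * M) ^ 2)) volume 0 T :=
      intervalIntegrable_const
    have hconst : ∫ _ in (0 : ℝ)..T, 2 * (K * (‖u (t i) - v₀‖ * M) ^ 2) =
        T * (2 * (K * (‖u (t i) - v₀‖ * M) ^ 2)) := by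
      rw [intervalIntegral.integral_const, sub_zero, smul_eq_mul]
    rw [← intervalIntegral.integral_const_mul, ← hconst, ← intervalIntegral.integral_add hI1 hI2]
    refine intervalIntegral.integral_mono_on hT.le
      ((hcont.mono (Set.uIcc_of_le hT.le).subset).intervalIntegrable) (hI1.add hI2) fun σ hσ => ?_
    refine (dissipation_le_add hac ha0 (v σ) (u (t i + σ))).trans ?_
    have h1 := hK (u (t i + σ) - v σ)
    have h2 : ‖u (t i + σ) - v σ‖ ^ 2 ≤ (‖u (t i) - v₀‖ * M) ^ 2 :=
      pow_le_pow_left₀ (norm_nonneg _) (hcl σ hσ) 2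
    have h3 := mul_le_mul_of_nonneg_left h2 hK0
    linarith
  have hlim : Tendsto (fun i => 2 * (∫ σ in (0 : ℝ)..T, dissipation a (u (t i + σ))) +
      T * (2 * (K * (‖u (t i) - v₀‖ * M) ^ 2))) l (𝓝 0) := by
    have h1 := (hu.tendsto_integral_dissipation ha ha0 ht hT.le).const_mul 2
    have h2 := (((((hstrong.mul_const M).pow 2).const_mul K).const_mul 2).const_mul T)
    simpa using h1.add h2
  have hint : ∫ σ in (0 : ℝ)..T, dissipation a (v σ) ≤ 0 := ge_of_tendsto hlim hle
  by_contra hne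
  have hpos' := intervalIntegral.integral_pos hT hcont (fun σ _ => dissipation_nonneg ha0 _)
    ⟨τ, ⟨hτ, by linarith⟩, lt_of_le_of_ne (dissipation_nonneg ha0 _) (Ne.symm hne)⟩
  linarith

lemma ae_eq_zero_of_dissipation_eq_zero (ha : Continuous a) (ha0 : ∀ x, 0 ≤ a x) {w : L2}
    (hw : dissipation a w = 0) : ∀ᵐ x ∂torusMeasure, a x * w x = 0 := by
  have h := (integral_eq_zero_iff_of_nonneg (fun x => mul_nonneg (ha0 x) (sq_nonneg (w x)))
    (integrable_dissipation ha w)).mp hw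
  filter_upwards [h] with x hx
  simpa using hx

lemma field_eq_field_zero {w : L2} (hw : ∀ᵐ x ∂torusMeasure, a x * w x = 0) :
    field a w = field 0 w := by
  unfold field
  rw [coeff_congr (f := fun x => a x * w x) (g := fun x => (0 : Torus → ℝ) x * w x)]
  filter_upwards [hw] with x hx
  rw [hx, Pi.zero_apply, zero_mul]

lemma contDiff_zero_torus :
    ContDiff ℝ (⊤ : ℕ∞) (fun x : ℝ => (0 : Torus → ℝ) (x : Torus)) := contDiff_const

/-- A solution issued from a weak limit point of a trajectory does not feel the damping: it solves
the undamped equation and vanishes where `a > 0`. -/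
theorem vanishesOn_of_weakTendstoH (ha : ContDiff ℝ (⊤ : ℕ∞) (fun x : ℝ => a (x : Torus)))
    (ha0 : ∀ x, 0 ≤ a x) {ω : Set Torus} (ha_pos : ∀ x ∈ ω, 0 < a x)
    (hu : IsGlobalSolution a 1 u₀ u) {ι : Type*} {l : Filter ι} [l.NeBot] {t : ι → ℝ}
    (ht : Tendsto t l atTop) (hw : WeakTendstoH 1 (fun i => u (t i)) l v₀) {T : ℝ} (hT : 0 < T)
    {y : ℝ → L2} (hy : IsSolutionOn 0 1 T v₀ y) : VanishesOn ω T y := by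
  obtain ⟨v, hv⟩ := exists_globalSolution ha ha0 hw.2.1
  have hzero : ∀ τ, 0 ≤ τ → ∀ᵐ x ∂torusMeasure, a x * v τ x = 0 := fun τ hτ =>
    ae_eq_zero_of_dissipation_eq_zero (continuous_of_contDiff ha) ha0
      (dissipation_eq_zero_of_weakTendstoH ha ha0 hu hv ht hw hτ)
  have hv0 : IsSolutionOn 0 1 T v₀ v := by
    refine ⟨(hv T hT).1, fun τ hτ => ?_⟩
    rw [(hv T hT).2 τ hτ]
    congr 1
    refine intervalIntegral.integral_congr fun σ hσ => ?_
    rw [Set.uIcc_of_le hτ.1] at hσ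
    exact field_eq_field_zero (hzero σ hσ.1)
  obtain ⟨A, hA, hAs⟩ := exists_memH_of_contDiff contDiff_zero_torus
  intro τ hτ
  rw [hy.eqOn hA zero_le_one (hAs 1) hT.le hv0 (Set.Ioo_subset_Icc_self hτ)]
  filter_upwards [hzero τ hτ.1.le] with x hx hxω
  exact (mul_eq_zero.mp hx).resolve_left (ha_pos x hxω).ne'

theorem eq_zero_of_weakTendstoH (ha : ContDiff ℝ (⊤ : ℕ∞) (fun x : ℝ => a (x : Torus)))
    (ha0 : ∀ x, 0 ≤ a x) {ω : Set Torus} (hω : IsOpen ω) (ha_pos : ∀ x ∈ ω, 0 < a x)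
    (hu : IsGlobalSolution a 1 u₀ u) {ι : Type*} {l : Filter ι} [l.NeBot] {t : ι → ℝ}
    (ht : Tendsto t l atTop) (hw : WeakTendstoH 1 (fun i => u (t i)) l v₀) (hne : ω.Nonempty)
    {δ : ℝ} (hδ : UCPBelow δ) (hsmall : normH 1 u₀ < δ ∨ normH 1 v₀ < δ) : v₀ = 0 := by
  have hle : normH 1 v₀ ≤ normH 1 u₀ := by
    refine hw.normH_le ?_
    filter_upwards [ht.eventually_ge_atTop 0] with i hi
    exact hu.normH_le ha ha0 hi
  have hv₀ : normH 1 v₀ < δ := hsmall.elim hle.trans_lt id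
  obtain ⟨v, hv⟩ := exists_globalSolution contDiff_zero_torus (fun _ => le_rfl) hw.2.1
  exact hδ v₀ hw.2.1 hv₀ ω hω hne 1 one_pos v (hv 1 one_pos)
    (vanishesOn_of_weakTendstoH ha ha0 ha_pos hu ht hw one_pos (hv 1 one_pos))

/-- Along every ultrafilter at infinity the trajectory has a weak limit, which must be zero; so each
Fourier coefficient tends to zero. -/
lemma tendsto_coeff_zero (ha : ContDiff ℝ (⊤ : ℕ∞) (fun x : ℝ => a (x : Torus)))
    (ha0 : ∀ x, 0 ≤ a x) {ω : Set Torus} (hω : IsOpen ω) (ha_pos : ∀ x ∈ ω, 0 < a x)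
    (hu : IsGlobalSolution a 1 u₀ u) (hne : ω.Nonempty)
    {δ : ℝ} (hδ : UCPBelow δ) (hsmall : normH 1 u₀ < δ) (n : ℤ) :
    Tendsto (fun t => coeff (u t) n) atTop (𝓝 0) := by
  rw [tendsto_iff_ultrafilter]
  intro g hg
  obtain ⟨v₀, hw⟩ := exists_weakTendstoH (s := 1) (R := normH 1 u₀) (f := u) zero_le_one g
    (hg ((eventually_ge_atTop 0).mono fun t ht => ⟨hu.memH ht, hu.normH_le ha ha0 ht⟩))
  have h0 : v₀ = 0 := eq_zero_of_weakTendstoH ha ha0 hω ha_pos hu (t := fun t => t)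
    (l := (g : Filter ℝ)) hg hw hne hδ (Or.inl hsmall)
  have h := hw.tendsto_coeff n
  rwa [h0, coeff_zero] at h

end Global

end BBM

end

theorem mainTheorem1
    (a : BBM.Torus → ℝ)
    (ha_smooth : ContDiff ℝ (⊤ : ℕ∞) (fun x : ℝ => a (x : BBM.Torus)))
    (ha_nonneg : ∀ x, 0 ≤ a x)
    (ω : Set BBM.Torus) (hω : IsOpen ω) (ha_pos : ∀ x ∈ ω, 0 < a x) :
    -- local well-posedness in `H^s`: existence, Lipschitz dependence on the data, uniqueness
    (∀ s : ℝ, 0 ≤ s →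
      (∀ ρ : ℝ, 0 < ρ → ∃ T : ℝ, 0 < T ∧
        (∀ u₀ : BBM.L2, BBM.MemH s u₀ → BBM.normH s u₀ ≤ ρ →
          ∃ u : ℝ → BBM.L2, BBM.IsSolutionOn a s T u₀ u) ∧
        (∀ u₀ w₀ : BBM.L2, BBM.MemH s u₀ → BBM.normH s u₀ ≤ ρ →
          BBM.MemH s w₀ → BBM.normH s w₀ ≤ ρ →
          ∀ u w : ℝ → BBM.L2, BBM.IsSolutionOn a s T u₀ u → BBM.IsSolutionOn a s T w₀ w →
            ∀ t ∈ Set.Icc 0 T, BBM.normH s (u t - w t) ≤ 2 * BBM.normH s (u₀ - w₀))) ∧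
      (∀ T : ℝ, 0 < T → ∀ (u₀ : BBM.L2) (u w : ℝ → BBM.L2),
        BBM.IsSolutionOn a s T u₀ u → BBM.IsSolutionOn a s T u₀ w →
          Set.EqOn u w (Set.Icc 0 T))) ∧
    -- global existence in `H¹`
    (∀ u₀ : BBM.L2, BBM.MemH 1 u₀ → ∃ u : ℝ → BBM.L2, BBM.IsGlobalSolution a 1 u₀ u) ∧
    (∀ (u₀ : BBM.L2) (u : ℝ → BBM.L2), BBM.IsGlobalSolution a 1 u₀ u →
      -- the energy is nonincreasing
      AntitoneOn (fun t => BBM.normH 1 (u t) ^ 2) (Set.Ici 0) ∧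
      -- weak limit points
      (∀ (t : ℕ → ℝ) (v₀ : BBM.L2), Filter.Tendsto t Filter.atTop Filter.atTop →
        BBM.WeakTendstoH 1 (fun n => u (t n)) Filter.atTop v₀ →
          (∃ v : ℝ → BBM.L2, BBM.IsGlobalSolution 0 1 v₀ v) ∧
          (∀ T : ℝ, 0 < T → ∀ v : ℝ → BBM.L2,
            BBM.IsSolutionOn 0 1 T v₀ v → BBM.VanishesOn ω T v) ∧
          (ω.Nonempty → ∀ δ : ℝ, 0 < δ → BBM.UCPBelow δ →
            BBM.normH 1 u₀ < δ ∨ BBM.normH 1 v₀ < δ → v₀ = 0)) ∧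
      -- convergence to zero under unique continuation
      (ω.Nonempty → ∀ δ : ℝ, 0 < δ → BBM.UCPBelow δ → BBM.normH 1 u₀ < δ →
        BBM.WeakTendstoH 1 u Filter.atTop 0 ∧
        ∀ σ : ℝ, σ < 1 →
          Filter.Tendsto (fun t => BBM.normH σ (u t)) Filter.atTop (nhds 0))) := by
  obtain ⟨A, hA, hAs⟩ := BBM.exists_memH_of_contDiff ha_smooth
  refine ⟨fun s hs => ⟨fun ρ hρ => BBM.local_wellPosedness hA hs (hAs s) hρ,
      fun T hT u₀ u w hu hw => hu.eqOn hA hs (hAs s) hT.le hw⟩,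
    fun u₀ hu₀ => BBM.exists_globalSolution ha_smooth ha_nonneg hu₀,
    fun u₀ u hu => ⟨hu.antitoneOn_energy ha_smooth ha_nonneg, fun t v₀ ht hw => ⟨?_, ?_, ?_⟩,
      fun hne δ _ hδ hsmall => ?_⟩⟩
  · exact BBM.exists_globalSolution BBM.contDiff_zero_torus (fun _ => le_rfl) hw.2.1
  · exact fun T hT v hv =>
      BBM.vanishesOn_of_weakTendstoH ha_smooth ha_nonneg ha_pos hu ht hw hT hv
  · exact fun hne δ _ hδ hsmall =>
      BBM.eq_zero_of_weakTendstoH ha_smooth ha_nonneg hω ha_pos hu ht hw hne hδ hsmall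
  · have hb : ∀ᶠ t in atTop, BBM.MemH 1 (u t) ∧ BBM.normH 1 (u t) ≤ BBM.normH 1 u₀ :=
      (eventually_ge_atTop 0).mono fun t ht =>
        ⟨hu.memH ht, hu.normH_le ha_smooth ha_nonneg ht⟩
    have hc := BBM.tendsto_coeff_zero ha_smooth ha_nonneg hω ha_pos hu hne hδ hsmall
    refine ⟨BBM.weakTendstoH_of_tendsto_coeff hb (BBM.memH_zero 1) fun n => ?_,
      fun σ hσ => BBM.tendsto_normH_of_tendsto_coeff hσ hb hc⟩
    rw [BBM.coeff_zero]
    exact hc n
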